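/- Let $0<\delta<T<\infty$, let $R$ be a finite Borel measure on $[\delta,T]^2$, and let $V_R$ be a set-indexed Wiener process with time $R$, i.e. a zero-mean Gaussian process indexed by the Borel sets $B\subset[\delta,T]^2$ with $E[V_R(B)V_R(B')]=R(B\cap B')$. Let $Z_1,\dots,Z_\nu$ be arbitrary random variables on the same probability space, let $Q_1,\dots,Q_\nu$ be deterministic signed measures on $[\delta,T]^2$, and let $$\xi(B)=V_R(B)+\sum_{j=1}^\nu Q_j(B)Z_j=V_R(B)+\mathbf Q^\top(B)\mathbf Z .$$ Suppose there are functions $q_j:[\delta,T]^2\to\mathbb R$, square-integrable with respect to $R$, with $Q_j(B)=\iint_B q_j\,dR$ for all Borel $B\subset[\delta,T]^2$, $1\le j\le\nu$, and write $\mathbf q=(q_1,\dots,q_\nu)^\top$. Let $\{A_u:0\le u\le1\}$ be a scanning family over $[\delta,T]^2$: Borel subsets of $[\delta,T]^2$ such that (i) $\mathrm{Leb}(A_0)=0$ and $\mathrm{Leb}(A_1)=(T-\delta)^2$; (ii) $A_u\subset A_{u'}$ if $u\le u'$; (iii) $\mathrm{Leb}(A_{u'}\setminus A_u)\to0$ if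 $u'\downarrow u$. Assume also that the scanning is continuous with respect to $R$, that is, $R(A_0)=0$, $R(A_1)=R([\delta,T]^2)$ and $u\mapsto R(A_u)$ is continuous on $[0,1]$ (given (i)--(iii), this holds for instance if $R\ll\mathrm{Leb}$ and $u\mapsto\mathrm{Leb}(A_u)$ is left-continuous). Complements are taken in $[\delta,T]^2$. Assume that the matrices $$\mathbf I(A_u^c)=\iint_{A_u^c}\mathbf q\,\mathbf q^\top\,dR,\qquad u\in[0,1),$$ are invertible. Then the process $$W_R(B)=\xi(B)-\int_0^1\mathbf Q^\top(B\cap A_{du})\,\mathbf I^{-1}(A_u^c)\iint_{A_u^c}\mathbf q\,d\xi$$ is well defined and is a set-indexed Wiener process with time $R$. Here $\iint_{C} f\,d\xi$, for $f\in L^2(R)$, is the limit in probability of the integrals of simple functions converging to $f$ in $L^2(R)$ on $C$; for the inner integrals a version jointly measurable in $(u,\omega)$ is taken. $Q_j(B\cap A_{du})$ is the signed measure on $[0,1]$ generated by $u\mapsto Q_j(B\cap A_u)$. The outer integral is the limit in probability, as $u_0\uparrow1$, of the path-by-path Lebesgue--Stieltjes integrals over $[0,u_0]$, which converge absolutely almost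 surely; this limit exists for every $B$, and every process obtained in this way is a Wiener process with time $R$. -/

import Mathlib

open MeasureTheory ProbabilityTheory Filter Topology
open scoped unitInterval Matrix

/-- The square `[δ, T]²`, as a space of its own, with the Borel σ-algebra of the plane. The complement
of a subset is taken in the square. -/
abbrev Square (δ T : ℝ) : Type := Set.Icc ((δ, δ) : ℝ × ℝ) (T, T)

/-- Lebesgue measure on the square `[δ, T]²`. -/
noncomputable def leb (δ T : ℝ) : Measure (Square δ T) :=
  (volume : Measure (ℝ × ℝ)).comap Subtype.val

/-- The Borel subsets of a measurable space, which index the set-indexed processes. -/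
abbrev BorelSets (E : Type*) [MeasurableSpace E] : Type _ := {B : Set E // MeasurableSet B}

/-- A set-indexed Wiener process with time `R`: a zero-mean Gaussian process, indexed by the Borel
sets, with covariance `R (B ∩ B')`. -/
structure IsSetIndexedWiener {E Ω : Type*} [MeasurableSpace E] [MeasurableSpace Ω]
    (R : Measure E) (P : Measure Ω) (V : BorelSets E → Ω → ℝ) : Prop where
  gaussian : IsGaussianProcess V P
  mean_zero : ∀ B : BorelSets E, ∫ ω, V B ω ∂P = 0
  covariance : ∀ B B' : BorelSets E,
    ∫ ω, V B ω * V B' ω ∂P = R.real ((B : Set E) ∩ (B' : Set E))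

/-- A scanning family over `[δ, T]²`: Borel subsets `A u`, `0 ≤ u ≤ 1`, of the square, increasing
and right-continuous in `u` with respect to Lebesgue measure, that exhaust the square from a null
set. -/
structure IsScanningFamily {δ T : ℝ} (A : I → BorelSets (Square δ T)) : Prop where
  leb_zero : leb δ T (A 0 : Set (Square δ T)) = 0
  leb_one : leb δ T (A 1 : Set (Square δ T)) = ENNReal.ofReal ((T - δ) ^ 2)
  mono : ∀ u u' : I, u ≤ u' → (A u : Set (Square δ T)) ⊆ (A u' : Set (Square δ T))
  right_cont : ∀ u : I,
    Tendsto (fun u' : I => leb δ T ((A u' : Set (Square δ T)) \ (A u : Set (Square δ T))))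
      (𝓝[>] u) (𝓝 0)

/-- The integral `∫_C φ dξ` of a simple function against a set-indexed process. -/
noncomputable def elemIntegral {E Ω : Type*} [MeasurableSpace E]
    (ξ : BorelSets E → Ω → ℝ) (C : BorelSets E) (φ : SimpleFunc E ℝ) (ω : Ω) : ℝ :=
  ∑ c ∈ φ.range, c * ξ (C ∩ ⟨φ ⁻¹' {c}, φ.measurableSet_fiber c⟩) ω

/-- `X` is (a version of) the stochastic integral `∫_C f dξ`: it is the limit in probability of the
integrals `∫_C φ n dξ` for every sequence of simple functions `φ n` that converges to `f` in
`L²(R)` on `C`. Simple functions being dense, this determines `X` almost surely when `f` is in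
`L²(R)`. -/
def IsStochIntegral {E Ω : Type*} [MeasurableSpace E] [MeasurableSpace Ω]
    (R : Measure E) (P : Measure Ω) (ξ : BorelSets E → Ω → ℝ) (C : BorelSets E)
    (f : E → ℝ) (X : Ω → ℝ) : Prop :=
  ∀ φ : ℕ → SimpleFunc E ℝ,
    Tendsto (fun n => eLpNorm (fun x => φ n x - f x) 2 (R.restrict (C : Set E))) atTop (𝓝 0) →
    TendstoInMeasure P (fun n => elemIntegral ξ C (φ n)) atTop X

/-- The matrix `∫_C q qᵀ dR`. -/
noncomputable def infoMatrix {E : Type*} [MeasurableSpace E] {ν : ℕ}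
    (R : Measure E) (q : Fin ν → E → ℝ) (C : BorelSets E) : Matrix (Fin ν) (Fin ν) ℝ :=
  Matrix.of fun i j => ∫ x in (C : Set E), q i x * q j x ∂ R

/-- Along an increasing family `A u`, a signed measure has bounded variation. -/
theorem boundedVariationOn_scan {E : Type*} [MeasurableSpace E] (Q : SignedMeasure E)
    (A : I → BorelSets E) (hA : ∀ u u' : I, u ≤ u' → (A u : Set E) ⊆ (A u' : Set E))
    (B : BorelSets E) :
    BoundedVariationOn (fun u : I => Q ((B : Set E) ∩ (A u : Set E))) Set.univ := by
  have hm : ∀ u, MeasurableSet ((B : Set E) ∩ (A u : Set E)) := fun u => B.2.inter (A u).2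
  set g : I → ℝ := fun u => Q.totalVariation.real ((B : Set E) ∩ (A u : Set E)) with hg
  have key : ∀ u u' : I, u ≤ u' →
      |Q ((B : Set E) ∩ (A u' : Set E)) - Q ((B : Set E) ∩ (A u : Set E))| ≤ g u' - g u := by
    intro u u' h
    have hs : (B : Set E) ∩ (A u : Set E) ⊆ (B : Set E) ∩ (A u' : Set E) :=
      Set.inter_subset_inter_right _ (hA u u' h)
    have h1 := VectorMeasure.of_add_of_sdiff (v := Q) (hm u) (hm u') hs
    have h2 := measureReal_sdiff (μ := Q.totalVariation) hs (hm u)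
    have h3 := SignedMeasure.norm_le_totalVariation Q
      (((B : Set E) ∩ (A u' : Set E)) \ ((B : Set E) ∩ (A u : Set E)))
    rw [Real.norm_eq_abs] at h3
    rw [← h1, add_sub_cancel_left, hg]
    simp only
    rw [← h2]
    exact h3
  have hmono : Monotone g := fun u u' h => by
    have := (abs_nonneg _).trans (key u u' h); linarith
  have hg' : BoundedVariationOn g Set.univ := by
    have h1 := (hmono.monotoneOn Set.univ).eVariationOn_eq (Set.mem_univ 0) (Set.mem_univ 1)
    have h2 : (Set.univ : Set I) ∩ Set.Icc 0 1 = Set.univ := by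
      ext x; simp only [Set.mem_inter_iff, Set.mem_univ, true_and, iff_true]
      exact ⟨x.2.1, x.2.2⟩
    rw [h2] at h1
    exact ne_top_of_le_ne_top ENNReal.ofReal_ne_top h1.le
  refine ne_top_of_le_ne_top hg' ?_
  refine iSup_le fun p => ?_
  refine le_trans (Finset.sum_le_sum fun i _ => ?_) (eVariationOn.sum_le p.2.2.1 p.2.2.2)
  rw [edist_dist, edist_dist]
  refine ENNReal.ofReal_le_ofReal ?_
  rw [Real.dist_eq, Real.dist_eq]
  exact (key _ _ (p.2.2.1 (Nat.le_succ i))).trans (le_abs_self _)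

/-- The signed measure `Q (B ∩ A_{du})` on `[0, 1]` that is generated by `u ↦ Q (B ∩ A u)`. -/
noncomputable def scanMeasure {E : Type*} [MeasurableSpace E] (Q : SignedMeasure E)
    (A : I → BorelSets E) (hA : ∀ u u' : I, u ≤ u' → (A u : Set E) ⊆ (A u' : Set E))
    (B : BorelSets E) : SignedMeasure I :=
  (boundedVariationOn_scan Q A hA B).vectorMeasure

/-- `W` is (a version of) the innovation martingale transform
`W B = ξ B - ∫₀¹ Qᵀ(B ∩ A_{du}) I⁻¹(A_uᶜ) ∫_{A_uᶜ} q dξ` of `ξ`. Here `M u` are versions of the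
inner stochastic integrals `∫_{A_uᶜ} q dξ`, `u < 1`, that are jointly measurable in `(u, ω)`, so
that the outer integral can be taken path by path. As the inverse matrix blows up at `u = 1`, the
outer integral over `[0, 1)` is the limit in probability, as `u₀ ↑ 1`, of the Lebesgue-Stieltjes
integrals over `[0, u₀]`, which have to converge absolutely, almost surely. -/
def IsInnovationTransform {E Ω : Type*} [MeasurableSpace E] [MeasurableSpace Ω] {ν : ℕ}
    (R : Measure E) (P : Measure Ω) (Q : Fin ν → SignedMeasure E) (q : Fin ν → E → ℝ)
    (A : I → BorelSets E) (hA : ∀ u u' : I, u ≤ u' → (A u : Set E) ⊆ (A u' : Set E))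
    (ξ W : BorelSets E → Ω → ℝ) : Prop :=
  ∃ M : I → Ω → Fin ν → ℝ,
    Measurable (Function.uncurry M) ∧
    (∀ u : I, u < 1 → ∀ j, IsStochIntegral R P ξ (A u)ᶜ (q j) (fun ω => M u ω j)) ∧
    ∀ B : BorelSets E,
      (∀ u₀ : I, u₀ < 1 → ∀ j, ∀ᵐ ω ∂P,
        (scanMeasure (Q j) A hA B).IntegrableOn
          (fun u => ((infoMatrix R q (A u)ᶜ)⁻¹ *ᵥ M u ω) j) (Set.Iic u₀)) ∧
      TendstoInMeasure P
        (fun (u₀ : I) ω => ξ B ω -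
          ∑ j, ∫ᵛ u in Set.Iic u₀,
            ((infoMatrix R q (A u)ᶜ)⁻¹ *ᵥ M u ω) j ∂•(scanMeasure (Q j) A hA B))
        (𝓝[<] 1) (W B)

/-!
The proof is an `L²` computation. The Wiener process `V` extends to a linear isometry
`J : L²(R) → L²(P)` (`IsSetIndexedWiener.exists_linearIsometry`), whose values are centred Gaussian.
The stochastic integral of `f` over `C` against `ξ = V + ∑ j, Q j Z j` is then
`J (f 1_C) + ∑ j, ⟪f 1_C, q j⟫ Z j` almost surely (`isStochIntegral_driftedIntegral`,
`IsStochIntegral.ae_eq_driftedIntegral`). The family `A` enters through the arrival time `t y` of the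
scanning at the point `y`: up to null sets `A u = {t ≤ u}`, the law of `t` has no atoms, and
`Q j (B ∩ A_{du})` is the image under `t` of the measure `1_B q j dR` (`scanMeasure_eq_map`).

The estimates `I⁻¹(A_uᶜ) ∫_{A_uᶜ} q dξ` are therefore `J (p u) + Z`, where `p u = I⁻¹(A_uᶜ) q 1_{t > u}`
is the dual system of the tail scores `q 1_{t > u}`. Exchanging `J` with the path-by-path integral, for
a jointly measurable version (`integral_path_ae_eq`), the outer integral over `[0, s]` becomes
`J (K_s 1_B) + ∑ j, Q j (B ∩ A s) Z j`, with the compensator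
`K_s h = ∫_{t y ≤ s} h(y) q(y)ᵀ p(t y) dR(y)`. As `s ↑ 1` the drift terms cancel, and the transform at
`B` is `J (1_B - K 1_B)`, `K` being the limit of `K_s`. It is for this limit that the law of `t` must
not have an atom at `1`.

It remains to see that `h ↦ h - K h` preserves inner products. The dual scores satisfy
`⟪p_i u, p_j v⟫ = I⁻¹(min u v) i j`, so that `‖K_s h‖²` is the double integral of a symmetric kernel,
while `⟪h 1_{t ≤ s}, K_s h⟫` is its integral over the half `t y < t x`. As `t` has no atoms, the
diagonal is null and `‖K_s h‖² = 2 ⟪h 1_{t ≤ s}, K_s h⟫` (`norm_sq_compensator`), that is,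
`‖h 1_{t ≤ s} - K_s h‖ = ‖h 1_{t ≤ s}‖`. The resulting bound `‖K_s h‖ ≤ 2 ‖h 1_{t ≤ s}‖`, applied to
the part of `h` beyond `r`, also gives the convergence of `K_s h`, with no control on the growth of
`I⁻¹` near `1`.
-/

/-! ### Sums and products of limits in measure -/

section ConvergenceInMeasure

variable {Ω : Type*} [MeasurableSpace Ω] {P : Measure Ω}

theorem tendstoInMeasure_add {ι : Type*} {l : Filter ι}
    {f g : ι → Ω → ℝ} {F G : Ω → ℝ}
    (hf : TendstoInMeasure P f l F) (hg : TendstoInMeasure P g l G) :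
    TendstoInMeasure P (fun i ω => f i ω + g i ω) l (fun ω => F ω + G ω) := by
  rw [tendstoInMeasure_iff_dist] at *
  intro ε hε
  have h := (hf (ε / 2) (half_pos hε)).add (hg (ε / 2) (half_pos hε))
  rw [add_zero] at h
  refine tendsto_of_tendsto_of_tendsto_of_le_of_le tendsto_const_nhds h (fun _ => zero_le)
    fun i => ?_
  refine (measure_mono ?_).trans (measure_union_le _ _)
  intro ω hω
  by_contra hcon
  simp only [Set.mem_union, Set.mem_ofPred_eq, not_or, not_le] at hcon hω
  have := dist_add_add_le (f i ω) (g i ω) (F ω) (G ω)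
  linarith [hcon.1, hcon.2]

theorem tendstoInMeasure_const_mul [IsFiniteMeasure P] {ι : Type*} {l : Filter ι}
    [l.IsCountablyGenerated] {a : ι → ℝ} {a₀ : ℝ} (ha : Tendsto a l (𝓝 a₀))
    {Z : Ω → ℝ} (hZ : Measurable Z) :
    TendstoInMeasure P (fun i ω => a i * Z ω) l (fun ω => a₀ * Z ω) := by
  intro ε hε
  refine tendsto_of_seq_tendsto fun u hu => ?_
  exact tendstoInMeasure_of_tendsto_ae (f := fun n ω => a (u n) * Z ω)
    (fun n => (hZ.const_mul _).aestronglyMeasurable)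
    (ae_of_all _ fun ω => (ha.comp hu).mul_const _) ε hε

theorem tendstoInMeasure_finsetSum {ι κ : Type*} {l : Filter ι}
    (s : Finset κ) {f : κ → ι → Ω → ℝ} {F : κ → Ω → ℝ}
    (hf : ∀ k ∈ s, TendstoInMeasure P (f k) l (F k)) :
    TendstoInMeasure P (fun i ω => ∑ k ∈ s, f k i ω) l (fun ω => ∑ k ∈ s, F k ω) := by
  classical
  induction s using Finset.induction_on with
  | empty =>
    intro ε hε
    simpa [hε.not_ge] using tendsto_const_nhds
  | insert a s ha ih =>
    simp only [Finset.sum_insert ha]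
    exact tendstoInMeasure_add (hf a (Finset.mem_insert_self a s))
      (ih fun k hk => hf k (Finset.mem_insert_of_mem hk))

end ConvergenceInMeasure

/-! ### The Wiener integral -/

section WienerIntegral

variable {E Ω : Type*} [MeasurableSpace E] [MeasurableSpace Ω]
  {R : Measure E} {P : Measure Ω} {V : BorelSets E → Ω → ℝ}

theorem IsSetIndexedWiener.memLp (hV : IsSetIndexedWiener R P V) (B : BorelSets E) :
    MemLp (V B) 2 P :=
  (hV.gaussian.hasGaussianLaw_eval B).memLp_two

variable [IsFiniteMeasure R]

/-- The indicator function of a Borel set as an element of `L²(R)`. -/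
noncomputable def indL2 (R : Measure E) [IsFiniteMeasure R] (B : BorelSets E) : Lp ℝ 2 R :=
  indicatorConstLp 2 B.2 (measure_ne_top R _) (1 : ℝ)

theorem denseRange_linearCombination_indL2 :
    DenseRange (Finsupp.linearCombination ℝ (indL2 R)) := by
  have key : ∀ f : Lp ℝ 2 R,
      f ∈ (LinearMap.range (Finsupp.linearCombination ℝ (indL2 R))).topologicalClosure := by
    refine Lp.induction (by norm_num) _ ?_ ?_ ?_
    · intro c s hs hμs
      refine Submodule.le_topologicalClosure _ ⟨Finsupp.single ⟨s, hs⟩ c, ?_⟩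
      rw [Finsupp.linearCombination_single, Lp.simpleFunc.coe_indicatorConst, indL2]
      rw [indicatorConstLp, indicatorConstLp, ← MemLp.toLp_const_smul]
      refine MemLp.toLp_congr _ _ (ae_of_all _ fun x => ?_)
      by_cases hx : x ∈ s <;> simp [hx]
    · intro f g hf hg _ h1 h2
      exact Submodule.add_mem _ h1 h2
    · exact Submodule.isClosed_topologicalClosure _
  intro f
  have := key f
  rwa [← SetLike.mem_coe, Submodule.topologicalClosure_coe] at this

/-- The Wiener integral `f ↦ ∫ f dV`: as the Gram matrices of `V B` and of the indicators agree,
it extends from indicators to an isometry of `L²(R)` into `L²(P)`. -/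
theorem IsSetIndexedWiener.exists_linearIsometry (hV : IsSetIndexedWiener R P V) :
    ∃ J : Lp ℝ 2 R →ₗᵢ[ℝ] Lp ℝ 2 P, ∀ B, J (indL2 R B) =ᵐ[P] V B := by
  set v : BorelSets E → Lp ℝ 2 P := fun B => (hV.memLp B).toLp (V B) with hv
  have hgram : ∀ B B', inner ℝ (v B) (v B') = inner ℝ (indL2 R B) (indL2 R B') := by
    intro B B'
    rw [indL2, indL2, L2.real_inner_indicatorConstLp_one_indicatorConstLp_one, L2.inner_def,
      ← hV.covariance]
    refine integral_congr_ae ?_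
    filter_upwards [(hV.memLp B).coeFn_toLp, (hV.memLp B').coeFn_toLp] with ω h1 h2
    simp only [hv, h1, h2]
    simp [mul_comm]
  have hinner : ∀ c d : BorelSets E →₀ ℝ,
      inner ℝ (Finsupp.linearCombination ℝ v c) (Finsupp.linearCombination ℝ v d) =
      inner ℝ (Finsupp.linearCombination ℝ (indL2 R) c)
        (Finsupp.linearCombination ℝ (indL2 R) d) := by
    intro c d
    simp only [Finsupp.linearCombination_apply, Finsupp.sum, sum_inner, inner_sum, inner_smul_left,
      inner_smul_right, hgram]
  have hnorm : ∀ c : BorelSets E →₀ ℝ, ‖Finsupp.linearCombination ℝ v c‖ =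
      ‖Finsupp.linearCombination ℝ (indL2 R) c‖ := by
    intro c
    rw [@norm_eq_sqrt_real_inner, @norm_eq_sqrt_real_inner, hinner]
  have hb : ∃ C, ∀ c : BorelSets E →₀ ℝ, ‖Finsupp.linearCombination ℝ v c‖ ≤
      C * ‖Finsupp.linearCombination ℝ (indL2 R) c‖ :=
    ⟨1, fun c => by rw [one_mul, hnorm]⟩
  have hd := denseRange_linearCombination_indL2 (R := R)
  set J := (Finsupp.linearCombination ℝ v).extendOfNorm (Finsupp.linearCombination ℝ (indL2 R))
  have hJ : ∀ c, J (Finsupp.linearCombination ℝ (indL2 R) c) = Finsupp.linearCombination ℝ v c :=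
    fun c => LinearMap.extendOfNorm_eq hd hb c
  have hJn : ∀ f, ‖J f‖ = ‖f‖ := by
    intro f
    refine hd.induction_on (p := fun f => ‖J f‖ = ‖f‖) f
      (isClosed_eq (by fun_prop) (by fun_prop)) fun c => ?_
    rw [hJ, hnorm]
  refine ⟨⟨J.toLinearMap, hJn⟩, fun B => ?_⟩
  have h : J (indL2 R B) = v B := by simpa using hJ (Finsupp.single B 1)
  exact (congrArg (fun f : Lp ℝ 2 P => (f : Ω → ℝ)) h).eventuallyEq.trans (hV.memLp B).coeFn_toLp

variable {J : Lp ℝ 2 R →ₗᵢ[ℝ] Lp ℝ 2 P}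

theorem linearIsometry_linearCombination (hJ : ∀ B, J (indL2 R B) =ᵐ[P] V B)
    (c : BorelSets E →₀ ℝ) :
    J (Finsupp.linearCombination ℝ (indL2 R) c) =ᵐ[P] fun ω => ∑ B ∈ c.support, c B * V B ω := by
  have h1 : J (Finsupp.linearCombination ℝ (indL2 R) c) =
      ∑ B ∈ c.support, c B • J (indL2 R B) := by
    simp only [Finsupp.linearCombination_apply, Finsupp.sum, map_sum, map_smul]
  rw [h1]
  have h2 : ∀ᵐ ω ∂P, ∀ B ∈ c.support, (c B • J (indL2 R B) : Lp ℝ 2 P) ω = c B * V B ω := by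
    rw [Filter.eventually_all_finset]
    intro B _
    filter_upwards [Lp.coeFn_smul (c B) (J (indL2 R B)), hJ B] with ω h3 h4
    rw [h3, Pi.smul_apply, h4, smul_eq_mul]
  filter_upwards [Lp.coeFn_finsetSum c.support fun B => c B • J (indL2 R B), h2] with ω h3 h4
  rw [h3, Finset.sum_apply]
  exact Finset.sum_congr rfl h4

theorem integral_linearIsometry [IsProbabilityMeasure P] (hV : IsSetIndexedWiener R P V)
    (hJ : ∀ B, J (indL2 R B) =ᵐ[P] V B)
    (g : Lp ℝ 2 R) : ∫ ω, J g ω ∂P = 0 := by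
  have h0 : ∀ g : Lp ℝ 2 R, ∫ ω, J g ω ∂P =
      inner ℝ (indicatorConstLp 2 MeasurableSet.univ (measure_ne_top P _) (1 : ℝ)) (J g) := by
    intro g
    rw [L2.inner_indicatorConstLp_one, Measure.restrict_univ]
  rw [h0]
  refine denseRange_linearCombination_indL2.induction_on (p := fun g => inner ℝ
    (indicatorConstLp 2 MeasurableSet.univ (measure_ne_top P _) (1 : ℝ)) (J g) = (0 : ℝ)) g
    (isClosed_eq (by fun_prop) (by fun_prop)) fun c => ?_
  rw [← h0, integral_congr_ae (linearIsometry_linearCombination hJ c), integral_finsetSum]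
  · simp [integral_const_mul, hV.mean_zero]
  · intro B _
    exact ((hV.memLp B).integrable (by norm_num)).const_mul _

theorem linearCombination_hasGaussianLaw (hV : IsSetIndexedWiener R P V)
    (hJ : ∀ B, J (indL2 R B) =ᵐ[P] V B)
    (c : BorelSets E →₀ ℝ) :
    HasGaussianLaw (J (Finsupp.linearCombination ℝ (indL2 R) c)) P := by
  have h : HasGaussianLaw (fun ω => ∑ B ∈ c.support, c B • V B ω) P :=
    (hV.gaussian.smul c).hasGaussianLaw_fun_sum
  exact h.congr (linearIsometry_linearCombination hJ c).symm

/-- Both sides are continuous in `g` for the norm of `L²(R)`, and agree on the linear combinations of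
indicators, which are dense. -/
theorem charFun_linearIsometry [IsProbabilityMeasure P] (hV : IsSetIndexedWiener R P V)
    (hJ : ∀ B, J (indL2 R B) =ᵐ[P] V B)
    (g : Lp ℝ 2 R) (t : ℝ) :
    charFun (P.map (J g)) t = Complex.exp (-(t ^ 2 * ‖g‖ ^ 2 / 2 : ℝ)) := by
  have hint : ∀ f : Lp ℝ 2 P, charFun (P.map f) t = ∫ ω, Complex.exp (t * f ω * Complex.I) ∂P := by
    intro f
    rw [charFun_apply_real, integral_map (Lp.aestronglyMeasurable f).aemeasurable (by fun_prop)]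
  have hI : ∀ f : Lp ℝ 2 P, Integrable (fun ω => Complex.exp (t * f ω * Complex.I)) P := by
    intro f
    refine (integrable_const (1 : ℝ)).mono' ?_ (ae_of_all _ fun ω => ?_)
    · have := (Lp.aestronglyMeasurable f).aemeasurable
      exact (by fun_prop : AEMeasurable (fun ω => Complex.exp (t * f ω * Complex.I))
        P).aestronglyMeasurable
    · have := Complex.norm_exp_ofReal_mul_I (t * f ω)
      push_cast at this
      rw [this]
  have hlip : LipschitzWith ‖t‖₊ fun f : Lp ℝ 2 P => charFun (P.map f) t := by
    refine LipschitzWith.of_dist_le_mul fun f g => ?_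
    rw [dist_eq_norm, dist_eq_norm, hint, hint, ← integral_sub (hI f) (hI g)]
    have hfg : Integrable (fun ω => (f - g : Lp ℝ 2 P) ω) P :=
      (Lp.memLp (f - g)).integrable (by norm_num)
    calc _ ≤ ∫ ω, ‖t‖ * ‖(f - g : Lp ℝ 2 P) ω‖ ∂P := by
          refine norm_integral_le_of_norm_le (hfg.norm.const_mul _) ?_
          filter_upwards [Lp.coeFn_sub f g] with ω hω
          rw [hω, Pi.sub_apply, ← norm_mul]
          have h1 : Complex.exp (t * f ω * Complex.I) - Complex.exp (t * g ω * Complex.I) =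
              Complex.exp ((t * g ω : ℝ) * Complex.I) *
                (Complex.exp (Complex.I * (t * (f ω - g ω) : ℝ)) - 1) := by
            rw [mul_sub, ← Complex.exp_add]
            push_cast
            ring_nf
          rw [h1, norm_mul, Complex.norm_exp_ofReal_mul_I, one_mul]
          exact Real.norm_exp_I_mul_ofReal_sub_one_le
      _ = ‖t‖ * (eLpNorm (f - g : Lp ℝ 2 P) 1 P).toReal := by
          rw [integral_const_mul, integral_norm_eq_lintegral_enorm (Lp.aestronglyMeasurable _),
            eLpNorm_one_eq_lintegral_enorm]
      _ ≤ ‖t‖ * ‖f - g‖ := by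
          rw [Lp.norm_def]
          gcongr
          · exact Lp.eLpNorm_ne_top _
          · exact eLpNorm_le_eLpNorm_of_exponent_le (by norm_num) (Lp.aestronglyMeasurable _)
  refine denseRange_linearCombination_indL2.induction_on (p := fun g =>
    charFun (P.map (J g)) t = Complex.exp (-(t ^ 2 * ‖g‖ ^ 2 / 2 : ℝ))) g
    (isClosed_eq (hlip.continuous.comp J.continuous) (by fun_prop)) fun c => ?_
  set f := Finsupp.linearCombination ℝ (indL2 R) c
  have hL : HasGaussianLaw (J f) P := linearCombination_hasGaussianLaw hV hJ c
  have h0 := integral_linearIsometry hV hJ f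
  have hvar : Var[J f; P] = ‖f‖ ^ 2 := by
    rw [variance_of_integral_eq_zero hL.aemeasurable h0, ← J.norm_map, ← real_inner_self_eq_norm_sq,
      L2.inner_def]
    refine integral_congr_ae (ae_of_all _ fun ω => ?_)
    simp [sq]
  rw [hL.map_eq_gaussianReal, charFun_gaussianReal, h0, hvar]
  congr 1
  rw [Real.coe_toNNReal _ (by positivity)]
  push_cast
  ring

/-- Wiener integrals are Gaussian: in the limit of linear combinations of indicators, the
characteristic function keeps its form. -/
theorem hasGaussianLaw_linearIsometry [IsProbabilityMeasure P] (hV : IsSetIndexedWiener R P V)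
    (hJ : ∀ B, J (indL2 R B) =ᵐ[P] V B)
    (g : Lp ℝ 2 R) : HasGaussianLaw (J g) P := by
  constructor
  have hm : AEMeasurable (J g) P := (Lp.aestronglyMeasurable _).aemeasurable
  have := Measure.isProbabilityMeasure_map (μ := P) hm
  have h : P.map (J g) = gaussianReal 0 (‖g‖₊ ^ 2) := by
    refine Measure.ext_of_charFun ?_
    ext t
    rw [charFun_linearIsometry hV hJ, charFun_gaussianReal]
    congr 1
    push_cast
    ring
  rw [h]
  infer_instance

/-- A family of versions of Wiener integrals, whose integrands have the Gram matrix of the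
indicators, is a set-indexed Wiener process. -/
theorem isSetIndexedWiener_of_ae_eq [IsProbabilityMeasure P] (hV : IsSetIndexedWiener R P V)
    (hJ : ∀ B, J (indL2 R B) =ᵐ[P] V B)
    (g : BorelSets E → Lp ℝ 2 R)
    (hg : ∀ B B', inner ℝ (g B) (g B') = inner ℝ (indL2 R B) (indL2 R B'))
    {W : BorelSets E → Ω → ℝ} (hW : ∀ B, J (g B) =ᵐ[P] W B) : IsSetIndexedWiener R P W where
  gaussian := by
    refine IsGaussianProcess.congr (X := fun B => J (g B)) ⟨fun S => ⟨?_⟩⟩ hW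
    refine isGaussian_of_isGaussian_map fun L => ?_
    have hm : AEMeasurable (fun ω => S.restrict fun B => J (g B) ω) P :=
      aemeasurable_pi_lambda _ fun B => (Lp.aestronglyMeasurable _).aemeasurable
    rw [AEMeasurable.map_map_of_aemeasurable (by fun_prop) hm]
    refine (HasGaussianLaw.congr (hasGaussianLaw_linearIsometry hV hJ
      (∑ B : S, L (Pi.single B 1) • g B)) ?_).isGaussian_map
    rw [map_sum]
    have h2 : ∀ᵐ ω ∂P, ∀ B : S,
        (J (L (Pi.single B 1) • g B)) ω = L (Pi.single B 1) * J (g B) ω := by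
      rw [ae_all_iff]
      intro B
      rw [map_smul]
      filter_upwards [Lp.coeFn_smul (L (Pi.single B 1)) (J (g B))] with ω h
      rw [h, Pi.smul_apply, smul_eq_mul]
    filter_upwards [Lp.coeFn_finsetSum Finset.univ fun B : S => J (L (Pi.single B 1) • g B), h2]
      with ω h3 h4
    rw [h3, Finset.sum_apply, Function.comp_apply]
    simp only [h4]
    conv_rhs => rw [pi_eq_sum_univ' (S.restrict fun B => J (g B) ω), map_sum]
    refine Finset.sum_congr rfl fun B _ => ?_
    rw [map_smul, smul_eq_mul, mul_comm]
    congr 2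
  mean_zero B := by rw [← integral_congr_ae (hW B), integral_linearIsometry hV hJ]
  covariance B B' := by
    have h := hg B B'
    rw [indL2, indL2, L2.real_inner_indicatorConstLp_one_indicatorConstLp_one,
      ← J.inner_map_map, L2.inner_def] at h
    rw [← h]
    refine integral_congr_ae ?_
    filter_upwards [hW B, hW B'] with ω h1 h2
    simp [h1, h2, mul_comm]

end WienerIntegral

/-! ### Restrictions of square-integrable functions -/

section RestrictedFunctions

variable {E : Type*} [MeasurableSpace E] {R : Measure E} {f g : E → ℝ}

/-- The function `f · 1_S` as an element of `L²(R)`. -/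
noncomputable def setL2 (hf : MemLp f 2 R) (S : BorelSets E) : Lp ℝ 2 R :=
  (hf.indicator S.2).toLp _

theorem setL2_congr {hf : MemLp f 2 R} {hg : MemLp g 2 R} {S S' : BorelSets E}
    (h : (S : Set E).indicator f =ᵐ[R] (S' : Set E).indicator g) : setL2 hf S = setL2 hg S' :=
  MemLp.toLp_congr _ _ h

theorem setL2_congr_set (hf : MemLp f 2 R) {S S' : BorelSets E}
    (h : (S : Set E) =ᵐ[R] (S' : Set E)) : setL2 hf S = setL2 hf S' :=
  setL2_congr (indicator_ae_eq_of_ae_eq_set h)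

theorem setL2_univ (hf : MemLp f 2 R) {S : BorelSets E} (hS : (S : Set E) = Set.univ) :
    setL2 hf S = hf.toLp f := by
  simp [setL2, hS]

theorem indL2_eq_setL2 [IsFiniteMeasure R] (B : BorelSets E) :
    indL2 R B = setL2 (memLp_const (1 : ℝ)) B := rfl

theorem inner_setL2_left (hf : MemLp f 2 R) (S : BorelSets E) (g : Lp ℝ 2 R) :
    inner ℝ (setL2 hf S) g = ∫ x in (S : Set E), f x * g x ∂ R := by
  rw [L2.inner_def, ← integral_indicator S.2]
  refine integral_congr_ae ?_
  filter_upwards [(hf.indicator S.2).coeFn_toLp] with x hx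
  rw [setL2, hx]
  by_cases h : x ∈ (S : Set E) <;> simp [h, mul_comm]

theorem inner_setL2_setL2 (hf : MemLp f 2 R) (hg : MemLp g 2 R) (S S' : BorelSets E) :
    inner ℝ (setL2 hf S) (setL2 hg S') = ∫ x in (S : Set E) ∩ S', f x * g x ∂ R := by
  rw [inner_setL2_left, ← integral_indicator S.2, ← integral_indicator (S.2.inter S'.2)]
  refine integral_congr_ae ?_
  filter_upwards [(hg.indicator S'.2).coeFn_toLp] with x hx
  rw [setL2, Set.inter_indicator_mul]
  by_cases h : x ∈ (S : Set E) <;> by_cases h' : x ∈ (S' : Set E) <;> simp [h, h', hx]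

theorem norm_setL2_le_of_subset (hf : MemLp f 2 R) {S S' : BorelSets E}
    (h : (S : Set E) ⊆ S') : ‖setL2 hf S‖ ≤ ‖setL2 hf S'‖ := by
  rw [setL2, setL2, Lp.norm_toLp, Lp.norm_toLp]
  refine ENNReal.toReal_mono (hf.indicator S'.2).2.ne (eLpNorm_mono fun x => ?_)
  by_cases hx : x ∈ (S : Set E)
  · simp [hx, h hx]
  · simp [hx]

theorem tendsto_setL2 [IsFiniteMeasure R] (hf : MemLp f 2 R) {ι : Type*} {l : Filter ι}
    [l.IsCountablyGenerated] {S : ι → BorelSets E} {S₀ : BorelSets E}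
    (h : ∀ᵐ x ∂ R, ∀ᶠ i in l, x ∈ (S i : Set E) ↔ x ∈ (S₀ : Set E)) :
    Tendsto (fun i => setL2 hf (S i)) l (𝓝 (setL2 hf S₀)) := by
  have hm : ∀ i, MeasurableSet (symmDiff (S i : Set E) S₀) := fun i => (S i).2.symmDiff S₀.2
  have h0 : Tendsto (fun i => R (symmDiff (S i : Set E) S₀)) l (𝓝 0) := by
    have := tendsto_measure_of_ae_tendsto_indicator l (μ := R) MeasurableSet.empty hm
      (As := fun i => symmDiff (S i : Set E) S₀) MeasurableSet.univ (measure_ne_top _ _)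
      (Eventually.of_forall fun i => Set.subset_univ _) ?_
    · simpa using this
    · filter_upwards [h] with x hx
      filter_upwards [hx] with i hi
      simp [Set.mem_symmDiff, hi]
  rw [Metric.tendsto_nhds]
  intro ε hε
  obtain ⟨δ, hδ, hle⟩ := hf.eLpNorm_indicator_le (by norm_num) (by norm_num) (half_pos hε)
  filter_upwards [h0.eventually_le_const (ENNReal.ofReal_pos.2 hδ)] with i hi
  have h1 := hle _ (hm i) hi
  have h2 : eLpNorm ((S i : Set E).indicator f - (S₀ : Set E).indicator f) 2 R ≤
      ENNReal.ofReal (ε / 2) := by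
    refine le_trans (eLpNorm_mono fun x => ?_) h1
    by_cases h : x ∈ (S i : Set E) <;> by_cases h' : x ∈ (S₀ : Set E) <;>
      simp [h, h', Set.mem_symmDiff]
  rw [dist_eq_norm, setL2, setL2, ← MemLp.toLp_sub, Lp.norm_toLp]
  refine (ENNReal.toReal_mono ENNReal.ofReal_ne_top h2).trans_lt ?_
  rw [ENNReal.toReal_ofReal (by positivity)]
  linarith

end RestrictedFunctions

/-! ### Tail scores and dual scores -/

section Tail

variable {E : Type*} [MeasurableSpace E] {R : Measure E} {ν : ℕ}
  {q : Fin ν → E → ℝ} {t : E → I}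

/-- The set `{t > u}` of the points that a scanning with arrival times `t` has not yet reached at
time `u`. -/
def tailSet (ht : Measurable t) (u : I) : BorelSets E := ⟨t ⁻¹' Set.Ioi u, ht measurableSet_Ioi⟩

/-- The set `{t ≤ u}` of the points that a scanning with arrival times `t` has reached by
time `u`. -/
def headSet (ht : Measurable t) (u : I) : BorelSets E := ⟨t ⁻¹' Set.Iic u, ht measurableSet_Iic⟩

theorem continuous_setL2_tailSet [IsFiniteMeasure R] {f : E → ℝ} (hf : MemLp f 2 R)
    (ht : Measurable t) (hat : ∀ u, R (t ⁻¹' {u}) = 0) :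
    Continuous fun u => setL2 hf (tailSet ht u) := by
  rw [continuous_iff_continuousAt]
  intro v
  refine tendsto_setL2 hf ?_
  have : ∀ᵐ x ∂ R, t x ≠ v := measure_mono_null (fun x hx => by simpa using hx) (hat v)
  filter_upwards [this] with x hx
  rcases lt_or_gt_of_ne hx with h | h
  · filter_upwards [lt_mem_nhds h] with u hu
    simp [tailSet, hu.not_gt, h.not_gt]
  · filter_upwards [gt_mem_nhds h] with u hu
    simp [tailSet, hu, h]

theorem tendsto_setL2_headSet [IsFiniteMeasure R] {f : E → ℝ} (hf : MemLp f 2 R)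
    (ht : Measurable t) (hat : ∀ u, R (t ⁻¹' {u}) = 0) :
    Tendsto (fun u => setL2 hf (headSet ht u)) (𝓝[<] 1) (𝓝 (hf.toLp f)) := by
  rw [← setL2_univ hf (S := ⟨Set.univ, MeasurableSet.univ⟩) rfl]
  refine tendsto_setL2 hf ?_
  have : ∀ᵐ x ∂ R, t x ≠ 1 := measure_mono_null (fun x hx => by simpa using hx) (hat 1)
  filter_upwards [this] with x hx
  have h : t x < 1 := lt_of_le_of_ne le_top hx
  filter_upwards [nhdsWithin_le_nhds (lt_mem_nhds h)] with u hu
  simp [headSet, hu.le]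

theorem tendsto_norm_setL2_tailSet [IsFiniteMeasure R] {f : E → ℝ} (hf : MemLp f 2 R)
    (ht : Measurable t) (hat : ∀ u, R (t ⁻¹' {u}) = 0) :
    Tendsto (fun u => ‖setL2 hf (tailSet ht u)‖) (𝓝[<] 1) (𝓝 0) := by
  have h := ((continuous_setL2_tailSet hf ht hat).norm.tendsto 1).mono_left
    (nhdsWithin_le_nhds (s := Set.Iio 1))
  have h1 : setL2 hf (tailSet ht 1) = 0 := by
    have : Set.Ioi (1 : I) = ∅ := Set.Ioi_top
    simp only [setL2, tailSet, this, Set.preimage_empty, Set.indicator_empty]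
    exact MemLp.toLp_zero _
  simpa [h1] using h

/-- The function `q j · 1_{t > u}` in `L²(R)`. -/
noncomputable def tailScore (hq : ∀ j, MemLp (q j) 2 R) (ht : Measurable t) (j : Fin ν) (u : I) :
    Lp ℝ 2 R :=
  setL2 (hq j) (tailSet ht u)

variable (R q) in
/-- The matrix `∫_{t > u} q qᵀ dR`. -/
noncomputable def tailInfo (ht : Measurable t) (u : I) : Matrix (Fin ν) (Fin ν) ℝ :=
  infoMatrix R q (tailSet ht u)

/-- The components of `I⁻¹(u) q 1_{t > u}` in `L²(R)`, where `I(u) = ∫_{t > u} q qᵀ dR`. They are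
dual to the components of `q 1_{t > u}`. -/
noncomputable def dualScore (hq : ∀ j, MemLp (q j) 2 R) (ht : Measurable t) (j : Fin ν) (u : I) :
    Lp ℝ 2 R :=
  ∑ i, (tailInfo R q ht u)⁻¹ j i • tailScore hq ht i u

theorem inner_tailScore (hq : ∀ j, MemLp (q j) 2 R) (ht : Measurable t) (i j : Fin ν) (u v : I) :
    inner ℝ (tailScore hq ht i u) (tailScore hq ht j v) = tailInfo R q ht (max u v) i j := by
  rw [tailScore, tailScore, inner_setL2_setL2]
  simp [tailInfo, infoMatrix, tailSet, ← Set.preimage_inter, Set.Ioi_inter_Ioi]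

theorem isSymm_tailInfo (ht : Measurable t) (u : I) : (tailInfo R q ht u).IsSymm := by
  ext i j
  simp [tailInfo, infoMatrix, mul_comm]

theorem isSymm_tailInfo_inv (ht : Measurable t) (u : I) : ((tailInfo R q ht u)⁻¹).IsSymm := by
  rw [Matrix.IsSymm, Matrix.transpose_nonsing_inv, isSymm_tailInfo]

/-- As `I⁻¹(u) I(max u v) I⁻¹(v) = I⁻¹(min u v)`, the dual scores have the covariances of a
time-changed random walk. -/
theorem inner_dualScore (hq : ∀ j, MemLp (q j) 2 R) (ht : Measurable t) (i j : Fin ν) {u v : I}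
    (hu : IsUnit (tailInfo R q ht u)) (hv : IsUnit (tailInfo R q ht v)) :
    inner ℝ (dualScore hq ht i u) (dualScore hq ht j v) = (tailInfo R q ht (min u v))⁻¹ i j := by
  have h1 : inner ℝ (dualScore hq ht i u) (dualScore hq ht j v) =
      ((tailInfo R q ht u)⁻¹ * tailInfo R q ht (max u v) * (tailInfo R q ht v)⁻¹) i j := by
    simp only [dualScore, sum_inner, inner_sum, inner_smul_left, inner_smul_right, inner_tailScore,
      Matrix.mul_apply, Finset.sum_mul]
    refine Finset.sum_congr rfl fun l _ => ?_
    rw [Finset.mul_sum]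
    refine Finset.sum_congr rfl fun k _ => ?_
    rw [← (isSymm_tailInfo_inv ht v).apply l j]
    simp
    ring
  rw [Matrix.isUnit_iff_isUnit_det] at hu hv
  rw [h1]
  rcases le_total u v with h | h
  · rw [max_eq_right h, min_eq_left h, mul_assoc, Matrix.mul_nonsing_inv _ hv, mul_one]
  · rw [max_eq_left h, min_eq_right h, Matrix.nonsing_inv_mul _ hu, one_mul]

theorem continuous_tailInfo [IsFiniteMeasure R] (hq : ∀ j, MemLp (q j) 2 R) (ht : Measurable t)
    (hat : ∀ u, R (t ⁻¹' {u}) = 0) : Continuous (tailInfo R q ht) := by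
  refine continuous_matrix fun i j => ?_
  have : (fun u => tailInfo R q ht u i j) =
      fun u => inner ℝ (tailScore hq ht i u) (tailScore hq ht j u) := by
    ext u; rw [inner_tailScore, max_self]
  rw [this]
  exact (continuous_setL2_tailSet (hq i) ht hat).inner (continuous_setL2_tailSet (hq j) ht hat)

theorem measurable_tailInfo_inv [IsFiniteMeasure R] (hq : ∀ j, MemLp (q j) 2 R) (ht : Measurable t)
    (hat : ∀ u, R (t ⁻¹' {u}) = 0) (i j : Fin ν) :
    Measurable fun u => (tailInfo R q ht u)⁻¹ i j := by
  have hc := continuous_tailInfo hq ht hat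
  simp only [Matrix.inv_def, Ring.inverse_eq_inv', Matrix.smul_apply, smul_eq_mul]
  exact hc.matrix_det.measurable.inv.mul (hc.matrix_adjugate.matrix_elem i j).measurable

theorem continuous_tailInfo_inv_min [IsFiniteMeasure R] (hq : ∀ j, MemLp (q j) 2 R)
    (ht : Measurable t) (hat : ∀ u, R (t ⁻¹' {u}) = 0)
    (hI : ∀ u < 1, IsUnit (tailInfo R q ht u)) {s : I} (hs : s < 1) (i j : Fin ν) :
    Continuous fun u => (tailInfo R q ht (min u s))⁻¹ i j := by
  have hc : Continuous fun u => tailInfo R q ht (min u s) :=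
    (continuous_tailInfo hq ht hat).comp (continuous_id.min continuous_const)
  simp only [Matrix.inv_def, Ring.inverse_eq_inv', Matrix.smul_apply, smul_eq_mul]
  refine (hc.matrix_det.inv₀ fun u => ?_).mul (hc.matrix_adjugate.matrix_elem i j)
  have := hI (min u s) ((min_le_right _ _).trans_lt hs)
  rw [Matrix.isUnit_iff_isUnit_det] at this
  exact this.ne_zero

theorem continuous_dualScore_min [IsFiniteMeasure R] (hq : ∀ j, MemLp (q j) 2 R)
    (ht : Measurable t) (hat : ∀ u, R (t ⁻¹' {u}) = 0)
    (hI : ∀ u < 1, IsUnit (tailInfo R q ht u)) {s : I} (hs : s < 1) (j : Fin ν) :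
    Continuous fun u => dualScore hq ht j (min u s) :=
  continuous_finsetSum _ fun i _ => (continuous_tailInfo_inv_min hq ht hat hI hs j i).smul
    ((continuous_setL2_tailSet (hq i) ht hat).comp (continuous_id.min continuous_const))

end Tail

/-! ### The compensator -/

section Compensator

variable {E : Type*} [MeasurableSpace E] {R : Measure E} {ν : ℕ}
  {q : Fin ν → E → ℝ} {t : E → I}

/-- The integrand `y ↦ h(y) q(y)ᵀ I⁻¹(t y) q 1_{t > t y}` of the compensator, with values in
`L²(R)`. -/
noncomputable def compIntegrand (hq : ∀ j, MemLp (q j) 2 R) (ht : Measurable t) (h : E → ℝ)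
    (y : E) : Lp ℝ 2 R :=
  ∑ j, (h y * q j y) • dualScore hq ht j (t y)

/-- The compensator `∫_{t(y) ≤ s} h(y) q(y)ᵀ I⁻¹(t y) q 1_{t > t y} dR(y)` of `h` up to time `s`, as
a Bochner integral in `L²(R)`. -/
noncomputable def compensator (hq : ∀ j, MemLp (q j) 2 R) (ht : Measurable t) (s : I)
    (h : E → ℝ) : Lp ℝ 2 R :=
  ∫ y in (headSet ht s : Set E), compIntegrand hq ht h y ∂ R

theorem integrable_mul_score (hq : ∀ j, MemLp (q j) 2 R) {h : E → ℝ} (hh : MemLp h 2 R)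
    (j : Fin ν) : Integrable (fun y => h y * q j y) R :=
  hh.integrable_mul (hq j)

variable (hq : ∀ j, MemLp (q j) 2 R) (ht : Measurable t)

theorem inner_compIntegrand (hI : ∀ u < 1, IsUnit (tailInfo R q ht u)) (h : E → ℝ) {x y : E}
    (hx : t x < 1) (hy : t y < 1) :
    inner ℝ (compIntegrand hq ht h x) (compIntegrand hq ht h y) =
      ∑ i, ∑ j, h x * q i x * (h y * q j y) * (tailInfo R q ht (min (t x) (t y)))⁻¹ i j := by
  simp only [compIntegrand, sum_inner]
  refine Finset.sum_congr rfl fun i _ => ?_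
  rw [inner_sum]
  refine Finset.sum_congr rfl fun j _ => ?_
  rw [real_inner_smul_left, real_inner_smul_right, inner_dualScore hq ht _ _ (hI _ hx) (hI _ hy)]
  ring

/-- Pairing `h` with the integrand at `y` only sees the points that are scanned after `y`; for these,
it integrates the inner products of the integrands themselves. -/
theorem inner_setL2_compIntegrand (hI : ∀ u < 1, IsUnit (tailInfo R q ht u)) {s : I} (hs : s < 1)
    {h : E → ℝ} (hh : MemLp h 2 R) {y : E} (hy : t y ≤ s) :
    inner ℝ (setL2 hh (headSet ht s)) (compIntegrand hq ht h y) =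
      ∫ x in (headSet ht s : Set E), (t ⁻¹' Set.Ioi (t y)).indicator
        (fun x => inner ℝ (compIntegrand hq ht h x) (compIntegrand hq ht h y)) x ∂ R := by
  have hS := (headSet ht s).2
  have hm : MeasurableSet (t ⁻¹' Set.Ioi (t y)) := ht measurableSet_Ioi
  rw [setIntegral_indicator hm]
  have h1 : ∀ x ∈ (headSet ht s : Set E) ∩ t ⁻¹' Set.Ioi (t y),
      inner ℝ (compIntegrand hq ht h x) (compIntegrand hq ht h y) =
      ∑ i, ∑ j, (h y * q j y * (tailInfo R q ht (t y))⁻¹ i j) * (h x * q i x) := by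
    intro x hx
    have hx1 : t x ≤ s := hx.1
    have hx2 : t y < t x := hx.2
    rw [inner_compIntegrand hq ht hI h (hx1.trans_lt hs) (hy.trans_lt hs), min_eq_right hx2.le]
    refine Finset.sum_congr rfl fun i _ => Finset.sum_congr rfl fun j _ => ?_
    ring
  rw [setIntegral_congr_fun (hS.inter hm) h1]
  have hi : ∀ i, IntegrableOn (fun x => h x * q i x)
      ((headSet ht s : Set E) ∩ t ⁻¹' Set.Ioi (t y)) R :=
    fun i => (integrable_mul_score hq hh i).integrableOn
  rw [integral_finsetSum _ fun i _ => integrable_finsetSum _ fun j _ => (hi i).const_mul _]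
  simp_rw [integral_finsetSum _ fun j _ => (hi _).const_mul _, integral_const_mul]
  simp only [compIntegrand, dualScore, tailScore, inner_sum, inner_smul_right, inner_setL2_setL2,
    tailSet]
  simp only [Finset.mul_sum]
  rw [Finset.sum_comm]
  refine Finset.sum_congr rfl fun i _ => Finset.sum_congr rfl fun j _ => ?_
  rw [(isSymm_tailInfo_inv ht (t y)).apply i j]
  ring

variable [IsFiniteMeasure R]

/-- Up to a time `s < 1` the dual scores are continuous in time, hence bounded. -/
theorem integrable_smul_dualScore (hat : ∀ u, R (t ⁻¹' {u}) = 0)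
    (hI : ∀ u < 1, IsUnit (tailInfo R q ht u)) {s : I} (hs : s < 1) {f : E → ℝ}
    (hf : Integrable f R) (j : Fin ν) :
    IntegrableOn (fun y => f y • dualScore hq ht j (t y)) (headSet ht s : Set E) R := by
  have hc := continuous_dualScore_min hq ht hat hI hs j
  obtain ⟨C, hC⟩ : ∃ C, ∀ u, ‖dualScore hq ht j (min u s)‖ ≤ C := by
    obtain ⟨C, hC⟩ := (isCompact_range hc).isBounded.exists_norm_le
    exact ⟨C, fun u => hC _ ⟨u, rfl⟩⟩
  have hm : AEStronglyMeasurable (fun y => dualScore hq ht j (min (t y) s)) R :=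
    (hc.stronglyMeasurable.comp_measurable ht).aestronglyMeasurable
  have h1 : Integrable (fun y => f y • dualScore hq ht j (min (t y) s)) R :=
    hf.smul_bdd C hm (ae_of_all _ fun y => hC _)
  refine h1.integrableOn.congr_fun (fun y hy => ?_) (headSet ht s).2
  have : t y ≤ s := hy
  simp only [min_eq_left this]

theorem integrable_compIntegrand (hat : ∀ u, R (t ⁻¹' {u}) = 0)
    (hI : ∀ u < 1, IsUnit (tailInfo R q ht u)) {s : I} (hs : s < 1) {h : E → ℝ}
    (hh : MemLp h 2 R) :
    IntegrableOn (compIntegrand hq ht h) (headSet ht s : Set E) R :=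
  integrable_finsetSum _ fun j _ =>
    integrable_smul_dualScore hq ht hat hI hs (integrable_mul_score hq hh j) j

/-- The double integral of `⟪k x, k y⟫`, `k` the integrand of the compensator, splits into the
parts before and after the diagonal, which are equal by symmetry; the diagonal itself is null, as
`t` has a continuous distribution. -/
theorem norm_sq_compensator (hat : ∀ u, R (t ⁻¹' {u}) = 0)
    (hI : ∀ u < 1, IsUnit (tailInfo R q ht u)) {s : I} (hs : s < 1) {h : E → ℝ}
    (hh : MemLp h 2 R) :
    ‖compensator hq ht s h‖ ^ 2 =
      2 * inner ℝ (setL2 hh (headSet ht s)) (compensator hq ht s h) := by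
  set S : Set E := (headSet ht s : Set E) with hSdef
  have hS : MeasurableSet S := (headSet ht s).2
  set k := compIntegrand hq ht h with hk
  have hki : Integrable k (R.restrict S) := integrable_compIntegrand hq ht hat hI hs hh
  set μ := R.restrict S with hμ
  set φ : E × E → ℝ := fun p => inner ℝ (k p.1) (k p.2) with hφ
  have hφi : Integrable φ (μ.prod μ) := by
    refine (hki.norm.mul_prod hki.norm).mono' (hki.1.comp_fst.inner hki.1.comp_snd)
      (ae_of_all _ fun p => norm_inner_le_norm _ _)
  set D : Set (E × E) := {p | t p.2 < t p.1} with hD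
  set D' : Set (E × E) := {p | t p.1 < t p.2} with hD'
  have hDm : MeasurableSet D :=
    measurableSet_lt (ht.comp measurable_snd) (ht.comp measurable_fst)
  have hDm' : MeasurableSet D' :=
    measurableSet_lt (ht.comp measurable_fst) (ht.comp measurable_snd)
  -- the left side is the full double integral
  have hL : ‖compensator hq ht s h‖ ^ 2 = ∫ p, φ p ∂(μ.prod μ) := by
    rw [← real_inner_self_eq_norm_sq (compensator hq ht s h), integral_prod _ hφi]
    have : ∀ x, ∫ y, φ (x, y) ∂μ = inner ℝ (k x) (∫ y, k y ∂μ) :=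
      fun x => integral_inner (𝕜 := ℝ) hki (k x)
    simp only [this]
    rw [compensator, ← integral_inner (𝕜 := ℝ) hki (∫ y, k y ∂μ)]
    exact integral_congr_ae (ae_of_all _ fun x => real_inner_comm _ _)
  -- the right side is the integral over the half `t y < t x`
  have hR : inner ℝ (setL2 hh (headSet ht s)) (compensator hq ht s h) =
      ∫ p, D.indicator φ p ∂(μ.prod μ) := by
    rw [integral_prod_symm _ (hφi.indicator hDm)]
    have h2 := integral_inner (𝕜 := ℝ) hki (setL2 hh (headSet ht s))
    rw [compensator, ← h2]
    refine setIntegral_congr_fun hS fun y hy => ?_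
    exact inner_setL2_compIntegrand hq ht hI hs hh hy
  have hswap : ∫ p, D'.indicator φ p ∂(μ.prod μ) = ∫ p, D.indicator φ p ∂(μ.prod μ) := by
    rw [← integral_prod_swap]
    refine integral_congr_ae (ae_of_all _ fun p => ?_)
    by_cases hp : t p.2 < t p.1
    · simp [D, D', hp, φ, real_inner_comm]
    · simp [D, D', hp]
  have hdiag : ∀ᵐ p ∂(μ.prod μ), t p.1 ≠ t p.2 := by
    have hm : MeasurableSet {p : E × E | t p.1 ≠ t p.2} :=
      (measurableSet_eq_fun (ht.comp measurable_fst) (ht.comp measurable_snd)).compl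
    rw [Measure.ae_prod_iff_ae_ae hm]
    refine ae_of_all _ fun x => ?_
    refine ae_restrict_of_ae ?_
    exact measure_mono_null (fun y hy => by simpa [eq_comm] using hy) (hat (t x))
  have hsplit : ∫ p, φ p ∂(μ.prod μ) =
      ∫ p, D.indicator φ p ∂(μ.prod μ) + ∫ p, D'.indicator φ p ∂(μ.prod μ) := by
    rw [← integral_add (hφi.indicator hDm) (hφi.indicator hDm')]
    refine integral_congr_ae ?_
    filter_upwards [hdiag] with p hp
    rcases lt_or_gt_of_ne hp with h1 | h1
    · simp [D, D', h1, h1.not_gt]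
    · simp [D, D', h1, h1.not_gt]
  rw [hL, hR, hsplit, hswap, two_mul]

theorem norm_setL2_sub_compensator (hat : ∀ u, R (t ⁻¹' {u}) = 0)
    (hI : ∀ u < 1, IsUnit (tailInfo R q ht u)) {s : I} (hs : s < 1) {h : E → ℝ}
    (hh : MemLp h 2 R) :
    ‖setL2 hh (headSet ht s) - compensator hq ht s h‖ = ‖setL2 hh (headSet ht s)‖ := by
  have h1 := norm_sub_sq_real (setL2 hh (headSet ht s)) (compensator hq ht s h)
  rw [norm_sq_compensator hq ht hat hI hs hh] at h1
  have h2 : ‖setL2 hh (headSet ht s) - compensator hq ht s h‖ ^ 2 =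
    ‖setL2 hh (headSet ht s)‖ ^ 2 := by linarith
  exact (pow_left_inj₀ (norm_nonneg _) (norm_nonneg _) two_ne_zero).1 h2

/-- As `h 1_{t ≤ s}` and its difference from the compensator have the same norm, the compensator is
bounded uniformly in `s`. -/
theorem norm_compensator_le (hat : ∀ u, R (t ⁻¹' {u}) = 0)
    (hI : ∀ u < 1, IsUnit (tailInfo R q ht u)) {s : I} (hs : s < 1) {h : E → ℝ}
    (hh : MemLp h 2 R) :
    ‖compensator hq ht s h‖ ≤ 2 * ‖setL2 hh (headSet ht s)‖ := by
  have h1 := norm_setL2_sub_compensator hq ht hat hI hs hh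
  have h2 := norm_sub_norm_le (compensator hq ht s h) (setL2 hh (headSet ht s))
  rw [norm_sub_rev, h1] at h2
  linarith

theorem compensator_add (hat : ∀ u, R (t ⁻¹' {u}) = 0)
    (hI : ∀ u < 1, IsUnit (tailInfo R q ht u)) {s : I} (hs : s < 1) {g h : E → ℝ}
    (hg : MemLp g 2 R) (hh : MemLp h 2 R) :
    compensator hq ht s (g + h) = compensator hq ht s g + compensator hq ht s h := by
  rw [compensator, compensator, compensator,
    ← integral_add (integrable_compIntegrand hq ht hat hI hs hg)
      (integrable_compIntegrand hq ht hat hI hs hh)]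
  simp only [compIntegrand, Pi.add_apply, add_mul, add_smul, Finset.sum_add_distrib]

theorem compensator_sub_compensator (hat : ∀ u, R (t ⁻¹' {u}) = 0)
    (hI : ∀ u < 1, IsUnit (tailInfo R q ht u)) {r s : I} (hrs : r ≤ s) (hs : s < 1) {h : E → ℝ}
    (hh : MemLp h 2 R) :
    compensator hq ht s h - compensator hq ht r h =
      compensator hq ht s ((tailSet ht r : Set E).indicator h) := by
  have hsub : (headSet ht r : Set E) ⊆ headSet ht s := fun x (hx : t x ≤ r) => hx.trans hrs
  have hk : compIntegrand hq ht ((tailSet ht r : Set E).indicator h) =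
      (tailSet ht r : Set E).indicator (compIntegrand hq ht h) := by
    ext1 y
    by_cases hy : y ∈ (tailSet ht r : Set E) <;> simp [compIntegrand, hy]
  have hset : (headSet ht s : Set E) ∩ tailSet ht r = (headSet ht s : Set E) \ headSet ht r := by
    ext x
    simp [headSet, tailSet]
  rw [compensator, compensator, compensator, hk, setIntegral_indicator (tailSet ht r).2, hset,
    setIntegral_sdiff (headSet ht r).2 (integrable_compIntegrand hq ht hat hI hs hh) hsub]

/-- A bound on the increments of the compensator that tends to zero as `r ↑ 1`, whatever the growth
of `I⁻¹`. -/
theorem norm_compensator_sub_le (hat : ∀ u, R (t ⁻¹' {u}) = 0)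
    (hI : ∀ u < 1, IsUnit (tailInfo R q ht u)) {r s : I} (hrs : r ≤ s) (hs : s < 1) {h : E → ℝ}
    (hh : MemLp h 2 R) :
    ‖compensator hq ht s h - compensator hq ht r h‖ ≤ 2 * ‖setL2 hh (tailSet ht r)‖ := by
  rw [compensator_sub_compensator hq ht hat hI hrs hs hh]
  refine (norm_compensator_le hq ht hat hI hs (hh.indicator (tailSet ht r).2)).trans ?_
  gcongr
  have h1 : setL2 (hh.indicator (tailSet ht r).2) (headSet ht s) =
      setL2 hh ⟨(headSet ht s : Set E) ∩ tailSet ht r, (headSet ht s).2.inter (tailSet ht r).2⟩ :=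
    setL2_congr (by simp only [Set.indicator_indicator]; rfl)
  rw [h1]
  exact norm_setL2_le_of_subset hh Set.inter_subset_right

instance nhdsLT_one_neBot : (𝓝[<] (1 : I)).NeBot :=
  nhdsLT_neBot_of_exists_lt ⟨0, zero_lt_one⟩

/-- The compensator up to time `s` converges in `L²(R)` as `s ↑ 1`, even though `I⁻¹` may blow up. -/
theorem exists_tendsto_compensator (hat : ∀ u, R (t ⁻¹' {u}) = 0)
    (hI : ∀ u < 1, IsUnit (tailInfo R q ht u)) {h : E → ℝ} (hh : MemLp h 2 R) :
    ∃ k, Tendsto (fun s => compensator hq ht s h) (𝓝[<] 1) (𝓝 k) := by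
  rw [← cauchy_map_iff_exists_tendsto, Metric.cauchy_iff]
  refine ⟨inferInstance, fun ε hε => ?_⟩
  have h0 := tendsto_norm_setL2_tailSet hh ht hat
  have h1 : ∀ᶠ r in 𝓝[<] (1 : I), ‖setL2 hh (tailSet ht r)‖ < ε / 2 :=
    h0.eventually_lt_const (half_pos hε)
  obtain ⟨r, hr, hr1⟩ := (h1.and self_mem_nhdsWithin).exists
  refine ⟨(fun s => compensator hq ht s h) '' Set.Ico r 1, image_mem_map ?_, ?_⟩
  · exact Ico_mem_nhdsLT hr1
  have key : ∀ a b : I, r ≤ a → a ≤ b → b < 1 →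
      dist (compensator hq ht b h) (compensator hq ht a h) < ε := by
    intro a b hra hab hb
    rw [dist_eq_norm]
    refine (norm_compensator_sub_le hq ht hat hI hab hb hh).trans_lt ?_
    have : ‖setL2 hh (tailSet ht a)‖ ≤ ‖setL2 hh (tailSet ht r)‖ :=
      norm_setL2_le_of_subset hh fun x (hx : a < t x) => hra.trans_lt hx
    linarith
  rintro _ ⟨a, ha, rfl⟩ _ ⟨b, hb, rfl⟩
  rcases le_total a b with hab | hab
  · rw [dist_comm]; exact key a b ha.1 hab hb.2
  · exact key b a hb.1 hab ha.2

/-- Subtracting the compensator preserves norms. -/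
theorem norm_sub_limit_compensator (hat : ∀ u, R (t ⁻¹' {u}) = 0)
    (hI : ∀ u < 1, IsUnit (tailInfo R q ht u)) {h : E → ℝ} (hh : MemLp h 2 R) {k : Lp ℝ 2 R}
    (hk : Tendsto (fun s => compensator hq ht s h) (𝓝[<] 1) (𝓝 k)) :
    ‖hh.toLp h - k‖ = ‖hh.toLp h‖ := by
  have h1 := tendsto_setL2_headSet hh ht hat
  refine tendsto_nhds_unique ((h1.sub hk).norm.congr' ?_) h1.norm
  filter_upwards [self_mem_nhdsWithin] with s hs
  exact norm_setL2_sub_compensator hq ht hat hI hs hh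

/-- Subtracting the compensator preserves inner products: by polarization, since it is additive and
preserves norms. -/
theorem inner_sub_limit_compensator (hat : ∀ u, R (t ⁻¹' {u}) = 0)
    (hI : ∀ u < 1, IsUnit (tailInfo R q ht u)) {g h : E → ℝ} (hg : MemLp g 2 R)
    (hh : MemLp h 2 R) {k l : Lp ℝ 2 R}
    (hk : Tendsto (fun s => compensator hq ht s g) (𝓝[<] 1) (𝓝 k))
    (hl : Tendsto (fun s => compensator hq ht s h) (𝓝[<] 1) (𝓝 l)) :
    inner ℝ (hg.toLp g - k) (hh.toLp h - l) = inner ℝ (hg.toLp g) (hh.toLp h) := by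
  have hkl : Tendsto (fun s => compensator hq ht s (g + h)) (𝓝[<] 1) (𝓝 (k + l)) := by
    refine (hk.add hl).congr' ?_
    filter_upwards [self_mem_nhdsWithin] with s hs
    exact (compensator_add hq ht hat hI hs hg hh).symm
  have h1 := norm_sub_limit_compensator hq ht hat hI hg hk
  have h2 := norm_sub_limit_compensator hq ht hat hI hh hl
  have h3 := norm_sub_limit_compensator hq ht hat hI (hg.add hh) hkl
  rw [MemLp.toLp_add, add_sub_add_comm] at h3
  rw [real_inner_eq_norm_add_mul_self_sub_norm_mul_self_sub_norm_mul_self_div_two,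
    real_inner_eq_norm_add_mul_self_sub_norm_mul_self_sub_norm_mul_self_div_two, h1, h2, h3]

end Compensator

/-! ### Integrals against a signed measure with a density -/

section DensityIntegral

variable {E : Type*} [MeasurableSpace E] {μ : Measure E} {f g : E → ℝ}

theorem integrable_withDensity_ofReal (hf : Integrable f μ)
    (hfg : Integrable (fun x => f x * g x) μ) (hg : AEStronglyMeasurable g μ) :
    Integrable g (μ.withDensity fun x => ENNReal.ofReal (f x)) := by
  rw [integrable_withDensity_iff_integrable_smul₀' hf.1.aemeasurable.ennreal_ofReal
    (ae_of_all _ fun x => ENNReal.ofReal_lt_top)]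
  refine hfg.mono ((hf.1.aemeasurable.ennreal_ofReal.ennreal_toReal.aestronglyMeasurable).smul hg)
    (ae_of_all _ fun x => ?_)
  rw [norm_smul, norm_mul]
  gcongr
  rw [ENNReal.toReal_ofReal', Real.norm_eq_abs, Real.norm_eq_abs, abs_of_nonneg (le_max_right _ _)]
  exact max_le (le_abs_self _) (abs_nonneg _)

theorem integral_withDensity_ofReal (hf : Integrable f μ) :
    ∫ x, g x ∂(μ.withDensity fun x => ENNReal.ofReal (f x)) = ∫ x, max (f x) 0 * g x ∂μ := by
  rw [integral_withDensity_eq_integral_toReal_smul₀ hf.1.aemeasurable.ennreal_ofReal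
    (ae_of_all _ fun x => ENNReal.ofReal_lt_top)]
  simp only [ENNReal.toReal_ofReal', smul_eq_mul]

theorem lsmul_eq_flip : ContinuousLinearMap.lsmul ℝ ℝ (E := ℝ) =
    (ContinuousLinearMap.lsmul ℝ ℝ (E := ℝ)).flip := by
  ext
  simp

/-- Integration against the signed measure with density `f`. -/
theorem integral_withDensityᵥ (hf : Integrable f μ)
    (hfg : Integrable (fun x => f x * g x) μ) (hg : AEStronglyMeasurable g μ) :
    ∫ᵛ x, g x ∂•(μ.withDensityᵥ f) = ∫ x, f x * g x ∂μ := by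
  have hfn : Integrable (fun x => -f x) μ := hf.neg
  have hfgn : Integrable (fun x => -f x * g x) μ := by simpa using hfg.neg
  have := isFiniteMeasure_withDensity_ofReal hf.2
  have := isFiniteMeasure_withDensity_ofReal hfn.2
  have h1 := integrable_withDensity_ofReal hf hfg hg
  have h2 := integrable_withDensity_ofReal hfn hfgn hg
  have key : ∀ {f : E → ℝ}, Integrable f μ → Integrable (fun x => f x * g x) μ →
      Integrable (fun x => max (f x) 0 * g x) μ := by
    intro f hf hfg
    have := integrable_withDensity_ofReal hf hfg hg
    rw [integrable_withDensity_iff_integrable_smul₀' hf.1.aemeasurable.ennreal_ofReal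
      (ae_of_all _ fun x => ENNReal.ofReal_lt_top)] at this
    simpa only [ENNReal.toReal_ofReal', smul_eq_mul] using this
  rw [withDensityᵥ_eq_withDensity_pos_part_sub_withDensity_neg_part hf,
    VectorMeasure.integral_sub_vectorMeasure, lsmul_eq_flip,
    VectorMeasure.integral_toSignedMeasure, VectorMeasure.integral_toSignedMeasure,
    integral_withDensity_ofReal hf, integral_withDensity_ofReal hfn,
    ← integral_sub (key hf hfg) (key hfn hfgn)]
  · refine integral_congr_ae (ae_of_all _ fun x => ?_)
    simp only
    rw [← sub_mul]
    congr 1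
    rcases le_total (f x) 0 with h | h
    · rw [max_eq_right h, max_eq_left (by linarith)]; ring
    · rw [max_eq_left h, max_eq_right (by linarith)]; ring
  · rwa [VectorMeasure.Integrable, Measure.variation_toSignedMeasure]
  · rwa [VectorMeasure.Integrable, Measure.variation_toSignedMeasure]

theorem integrable_variation_withDensityᵥ (hf : Integrable f μ)
    (hfg : Integrable (fun x => f x * g x) μ) (hg : AEStronglyMeasurable g μ) :
    (μ.withDensityᵥ f).Integrable g := by
  rw [VectorMeasure.Integrable, Measure.variation_withDensityᵥ hf,
    integrable_withDensity_iff_integrable_smul₀' hf.1.enorm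
    (ae_of_all _ fun x => enorm_lt_top)]
  refine hfg.mono ((hf.1.enorm.ennreal_toReal.aestronglyMeasurable).smul hg)
    (ae_of_all _ fun x => ?_)
  simp

end DensityIntegral

/-! ### Arrival times of a scanning family -/

section Arrival

variable {E : Type*} [MeasurableSpace E] {R : Measure E} {A : I → BorelSets E}

/-- The time at which the scanning `A` reaches a point; points that are never reached get the
time `1`. -/
noncomputable def arrival (A : I → BorelSets E) (x : E) : I := sInf {u | x ∈ (A u : Set E)}

theorem arrival_lt_iff {x : E} {a : I} : arrival A x < a ↔ ∃ u < a, x ∈ (A u : Set E) := by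
  rw [arrival, sInf_lt_iff]
  exact ⟨fun ⟨u, h1, h2⟩ => ⟨u, h2, h1⟩, fun ⟨u, h1, h2⟩ => ⟨u, h2, h1⟩⟩

variable (hA : ∀ u u' : I, u ≤ u' → (A u : Set E) ⊆ (A u' : Set E))

include hA in
theorem measurable_arrival : Measurable (arrival A) := by
  refine measurable_of_Iio fun a => ?_
  obtain ⟨D, hDc, hD⟩ := TopologicalSpace.exists_countable_dense I
  have : arrival A ⁻¹' Set.Iio a = ⋃ u ∈ {u ∈ D | u < a}, (A u : Set E) := by
    ext x
    simp only [Set.mem_preimage, Set.mem_Iio, Set.mem_iUnion, exists_prop, Set.mem_ofPred_eq]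
    constructor
    · intro hx
      obtain ⟨r, hrD, hr1, hr2⟩ := hD.exists_between hx
      obtain ⟨u, hu, hxu⟩ := arrival_lt_iff.1 hr1
      exact ⟨r, ⟨hrD, hr2⟩, hA u r hu.le hxu⟩
    · rintro ⟨u, ⟨-, hu⟩, hx⟩
      exact arrival_lt_iff.2 ⟨u, hu, hx⟩
  rw [this]
  exact MeasurableSet.biUnion (hDc.mono (Set.sep_subset _ _)) fun u _ => (A u).2

variable [IsFiniteMeasure R] (hone : R (A 1 : Set E)ᶜ = 0)
  (hcont : Continuous fun u : I => R (A u : Set E))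

include hone hcont in
/-- Up to a null set, the points reached by time `u` are those of `A u`. -/
theorem headSet_arrival_ae_eq (u : I) :
    (A u : Set E) =ᵐ[R] (headSet (measurable_arrival hA) u : Set E) := by
  have hsub : (A u : Set E) ⊆ headSet (measurable_arrival hA) u :=
    fun x hx => show arrival A x ≤ u from sInf_le hx
  refine ae_eq_of_subset_of_measure_ge hsub ?_ (A u).2.nullMeasurableSet (measure_ne_top _ _)
  rcases eq_or_lt_of_le (le_top : u ≤ ⊤) with rfl | hu
  · have h1 := measure_add_measure_compl (μ := R) (A ⊤).2
    have h2 : R (A ⊤ : Set E)ᶜ = 0 := hone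
    rw [h2, add_zero] at h1
    rw [h1]
    exact measure_mono (Set.subset_univ _)
  · have : (𝓝[>] u).NeBot := nhdsGT_neBot_of_exists_gt ⟨⊤, hu⟩
    -- for every `v > u`, the set `{t ≤ u}` is contained in `A v`
    refine ge_of_tendsto ((hcont.tendsto u).mono_left (nhdsWithin_le_nhds (s := Set.Ioi u))) ?_
    filter_upwards [self_mem_nhdsWithin] with v hv
    refine measure_mono fun x hx => ?_
    obtain ⟨w, hw, hxw⟩ := arrival_lt_iff.1 (lt_of_le_of_lt (show arrival A x ≤ u from hx) hv)
    exact hA w v hw.le hxw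

include hA hone hcont in
/-- The continuity of `u ↦ R (A u)` means that the law of the arrival time has no atoms. -/
theorem measure_arrival_eq (hzero : R (A 0 : Set E) = 0) (u : I) :
    R (arrival A ⁻¹' {u}) = 0 := by
  have hae := headSet_arrival_ae_eq hA hone hcont
  rcases eq_or_lt_of_le (bot_le : ⊥ ≤ u) with rfl | hu
  · refine measure_mono_null (t := headSet (measurable_arrival hA) ⊥) ?_ ?_
    · exact fun x (hx : arrival A x = ⊥) => hx.le
    · rw [← measure_congr (hae ⊥)]; exact hzero
  · have : (𝓝[<] u).NeBot := nhdsLT_neBot_of_exists_lt ⟨⊥, hu⟩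
    have h1 : Tendsto (fun v => R (A u : Set E) - R (A v : Set E)) (𝓝[<] u) (𝓝 0) := by
      have := ENNReal.Tendsto.sub (tendsto_const_nhds (x := R (A u : Set E)))
        ((hcont.tendsto u).mono_left (nhdsWithin_le_nhds (s := Set.Iio u)))
        (Or.inl (measure_ne_top _ _))
      simpa using this
    -- for every `v < u`, the set `{t = u}` is contained in `A u \ A v` up to a null set
    rw [← nonpos_iff_eq_zero]
    refine ge_of_tendsto h1 ?_
    filter_upwards [self_mem_nhdsWithin] with v hv
    rw [measure_congr (hae u), ← measure_sdiff ?_ (A v).2.nullMeasurableSet (measure_ne_top _ _)]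
    · refine measure_mono fun x (hx : arrival A x = u) => ⟨hx.le, fun hxv => ?_⟩
      have : arrival A x ≤ v := sInf_le hxv
      exact absurd (hx ▸ this) (not_le.2 hv)
    · exact fun x hx => (sInf_le (hA v u (le_of_lt hv) hx) : arrival A x ≤ u)

include hone hcont in
theorem compl_ae_eq_tailSet (u : I) :
    (((A u)ᶜ : BorelSets E) : Set E) =ᵐ[R] (tailSet (measurable_arrival hA) u : Set E) := by
  have h := (headSet_arrival_ae_eq hA hone hcont u).compl
  have h2 : ((headSet (measurable_arrival hA) u : Set E))ᶜ = tailSet (measurable_arrival hA) u := by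
    ext x; simp [headSet, tailSet]
  rw [h2] at h
  exact h

variable {Q : SignedMeasure E} {f : E → ℝ} (hf : MemLp f 2 R)
  (hQ : ∀ B : BorelSets E, Q (B : Set E) = ∫ x in (B : Set E), f x ∂ R)

include hA hone hcont hQ in
theorem apply_inter_scan (B : BorelSets E) (u : I) :
    Q ((B : Set E) ∩ A u) =
      ∫ x in arrival A ⁻¹' Set.Iic u, (B : Set E).indicator f x ∂ R := by
  have h1 := hQ ⟨(B : Set E) ∩ A u, B.2.inter (A u).2⟩
  rw [h1, setIntegral_indicator B.2]
  refine setIntegral_congr_set ?_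
  have h2 : ((B : Set E) ∩ (A u : Set E) : Set E) =ᵐ[R]
      ((B : Set E) ∩ arrival A ⁻¹' Set.Iic u : Set E) :=
    (ae_eq_refl _).inter (headSet_arrival_ae_eq hA hone hcont u)
  rw [Set.inter_comm (arrival A ⁻¹' Set.Iic u)]
  exact h2

include hA hone hcont hf hQ in
theorem continuous_apply_inter_scan (hzero : R (A 0 : Set E) = 0) (B : BorelSets E) :
    Continuous fun u => Q ((B : Set E) ∩ A u) := by
  have ht := measurable_arrival hA
  have hat := measure_arrival_eq hA hone hcont hzero
  have hfi : Integrable f R := hf.integrable (by norm_num)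
  have h : (fun u => Q ((B : Set E) ∩ A u)) = fun u =>
      (∫ x in (B : Set E), f x ∂ R) - inner ℝ (setL2 hf (tailSet ht u)) (indL2 R B) := by
    ext u
    rw [apply_inter_scan hA hone hcont hQ, indL2_eq_setL2, inner_setL2_setL2,
      ← integral_indicator B.2]
    have h2 := integral_add_compl (μ := R) (ht measurableSet_Iic : MeasurableSet
      (arrival A ⁻¹' Set.Iic u)) (hfi.indicator B.2)
    have h3 : (tailSet ht u : Set E) = (arrival A ⁻¹' Set.Iic u)ᶜ := by
      ext x; simp [tailSet]
    rw [h3, ← h2, setIntegral_indicator B.2 (s := (arrival A ⁻¹' Set.Iic u)ᶜ)]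
    simp
  rw [h]
  exact continuous_const.sub ((continuous_setL2_tailSet hf ht hat).inner continuous_const)

include hone hcont hf hQ in
/-- The measure `Q (B ∩ A_{du})` is the image of the measure `1_B f dR` under the arrival times. -/
theorem scanMeasure_eq_map (hzero : R (A 0 : Set E) = 0) (B : BorelSets E) :
    scanMeasure Q A hA B =
      (R.withDensityᵥ ((B : Set E).indicator f)).map (arrival A) := by
  have ht := measurable_arrival hA
  have hfi : Integrable ((B : Set E).indicator f) R := (hf.integrable (by norm_num)).indicator B.2
  have hc := continuous_apply_inter_scan hA hone hcont hf hQ hzero B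
  have key : ∀ a : I, scanMeasure Q A hA B (Set.Iic a) =
      (R.withDensityᵥ ((B : Set E).indicator f)).map (arrival A) (Set.Iic a) := by
    intro a
    have h0 : Q ((B : Set E) ∩ A 0) = 0 := by
      have h1 := hQ ⟨(B : Set E) ∩ A 0, B.2.inter (A 0).2⟩
      rw [h1]
      exact setIntegral_measure_zero _ (measure_mono_null Set.inter_subset_right hzero)
    have hIcc : Set.Iic a = Set.Icc 0 a := by
      ext x; simp
    rw [VectorMeasure.map_apply _ ht measurableSet_Iic,
      withDensityᵥ_apply hfi (ht measurableSet_Iic),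
      ← apply_inter_scan hA hone hcont hQ, hIcc, scanMeasure,
      BoundedVariationOn.vectorMeasure_Icc _ (zero_le : 0 ≤ a),
      hc.continuousAt.continuousWithinAt.rightLim_eq, hc.continuousAt.continuousWithinAt.leftLim_eq,
      h0, sub_zero]
  refine VectorMeasure.ext_of_generateFrom (Set.range Set.Iic) ?_
    (borel_eq_generateFrom_Iic I ▸ BorelSpace.measurable_eq) isPiSystem_Iic ?_
  · rintro _ ⟨a, rfl⟩
    exact key a
  · have := key ⊤
    rwa [Set.Iic_top] at this

include hf in
theorem restrict_map_withDensity (ht : Measurable (arrival A)) (B : BorelSets E) (s : I) :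
    ((R.withDensityᵥ ((B : Set E).indicator f)).map (arrival A)).restrict (Set.Iic s) =
      ((R.restrict (arrival A ⁻¹' Set.Iic s)).withDensityᵥ ((B : Set E).indicator f)).map
        (arrival A) := by
  have hfi : Integrable ((B : Set E).indicator f) R := (hf.integrable (by norm_num)).indicator B.2
  ext S hS
  rw [VectorMeasure.restrict_apply _ measurableSet_Iic hS,
    VectorMeasure.map_apply _ ht (hS.inter measurableSet_Iic), VectorMeasure.map_apply _ ht hS,
    withDensityᵥ_apply hfi (ht (hS.inter measurableSet_Iic)),
    withDensityᵥ_apply hfi.integrableOn (ht hS), Measure.restrict_restrict (ht hS)]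
  rfl

include hone hcont hf hQ in
theorem integrableOn_scanMeasure (hzero : R (A 0 : Set E) = 0) (B : BorelSets E) (s : I)
    {g : I → ℝ} (hg : Measurable g)
    (hi : IntegrableOn (fun y => (B : Set E).indicator f y * g (arrival A y))
      (arrival A ⁻¹' Set.Iic s) R) :
    (scanMeasure Q A hA B).IntegrableOn g (Set.Iic s) := by
  have ht := measurable_arrival hA
  have hfi : Integrable ((B : Set E).indicator f) R := (hf.integrable (by norm_num)).indicator B.2
  rw [VectorMeasure.IntegrableOn, scanMeasure_eq_map hA hone hcont hf hQ hzero,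
    restrict_map_withDensity hf ht]
  exact VectorMeasure.Integrable.map hg.aestronglyMeasurable
    (integrable_variation_withDensityᵥ hfi.integrableOn hi (hg.comp ht).aestronglyMeasurable)

include hone hcont hf hQ in
theorem integral_scanMeasure (hzero : R (A 0 : Set E) = 0) (B : BorelSets E) (s : I)
    {g : I → ℝ} (hg : Measurable g)
    (hi : IntegrableOn (fun y => (B : Set E).indicator f y * g (arrival A y))
      (arrival A ⁻¹' Set.Iic s) R) :
    ∫ᵛ u in Set.Iic s, g u ∂•(scanMeasure Q A hA B) =
      ∫ y in arrival A ⁻¹' Set.Iic s, (B : Set E).indicator f y * g (arrival A y) ∂ R := by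
  have ht := measurable_arrival hA
  have hfi : Integrable ((B : Set E).indicator f) R := (hf.integrable (by norm_num)).indicator B.2
  rw [scanMeasure_eq_map hA hone hcont hf hQ hzero, restrict_map_withDensity hf ht,
    VectorMeasure.integral_map ht hg.aestronglyMeasurable
      (integrable_variation_withDensityᵥ hfi.integrableOn hi (hg.comp ht).aestronglyMeasurable)]
  exact integral_withDensityᵥ hfi.integrableOn hi (hg.comp ht).aestronglyMeasurable

end Arrival

/-! ### Path-by-path computation of Bochner integrals -/

section MeasurableVersion

variable {S Y Ω : Type*} [MeasurableSpace S] [MeasurableSpace Y] [MeasurableSpace Ω]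
  {P : Measure Ω}

/-- A strongly measurable map into `L²(P)` has a jointly measurable version. It is the limit of
versions with countably many values, whose distance to the map is at most `2⁻ⁿ` at every point, so
that they converge almost surely. -/
theorem exists_measurable_uncurry_version {F : S → Lp ℝ 2 P} (hF : StronglyMeasurable F) :
    ∃ N : S → Ω → ℝ, Measurable (Function.uncurry N) ∧ ∀ u, N u =ᵐ[P] F u := by
  obtain ⟨c, hc, hFc⟩ := hF.isSeparable_range
  obtain ⟨d, hd⟩ := (hc.insert (0 : Lp ℝ 2 P)).exists_eq_range (Set.insert_nonempty _ _)
  have hex : ∀ n : ℕ, ∀ u, ∃ k, edist (F u) (d k) < (2⁻¹ : ENNReal) ^ n := by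
    intro n u
    have hmem : F u ∈ closure (Set.range d) :=
      closure_mono (hd ▸ Set.subset_insert _ _) (hFc (Set.mem_range_self u))
    obtain ⟨_, ⟨k, rfl⟩, hk⟩ := EMetric.mem_closure_iff.1 hmem ((2⁻¹ : ENNReal) ^ n)
      (ENNReal.pow_pos (by simp) n)
    exact ⟨k, hk⟩
  classical
  set κ : ℕ → S → ℕ := fun n u => Nat.find (hex n u) with hκ
  have hκm : ∀ n, Measurable (κ n) := fun n =>
    measurable_find (hex n) fun k =>
      measurableSet_lt (hF.edist stronglyMeasurable_const).measurable measurable_const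
  have hκlt : ∀ n u, edist (F u) (d (κ n u)) < (2⁻¹ : ENNReal) ^ n := fun n u =>
    Nat.find_spec (hex n u)
  have hdm : Measurable fun p : ℕ × Ω => d p.1 p.2 :=
    measurable_from_prod_countable_right fun k => (Lp.stronglyMeasurable (d k)).measurable
  refine ⟨fun u ω => limsup (fun n => d (κ n u) ω) atTop,
    Measurable.limsup (f := fun n (p : S × Ω) => d (κ n p.1) p.2) fun n =>
      hdm.comp (((hκm n).comp measurable_fst).prodMk measurable_snd), fun u => ?_⟩
  have hsum : ∑' n : ℕ, ((2⁻¹ : ENNReal) ^ n + 2⁻¹ ^ n) ≠ ⊤ := by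
    rw [ENNReal.tsum_add, ENNReal.tsum_geometric]
    simp
  have hlim : Tendsto (fun n => d (κ n u)) atTop (𝓝 (F u)) := by
    rw [tendsto_iff_edist_tendsto_0]
    refine tendsto_of_tendsto_of_tendsto_of_le_of_le tendsto_const_nhds
      (ENNReal.tendsto_pow_atTop_nhds_zero_of_lt_one (r := 2⁻¹) (by simp)) (fun _ => zero_le)
      fun n => ?_
    simpa only [edist_comm] using (hκlt n u).le
  obtain ⟨ns, hns, hsub⟩ := (tendstoInMeasure_of_tendsto_Lp hlim).exists_seq_tendsto_ae
  have hae := Lp.ae_tendsto_of_cauchy_eLpNorm (μ := P) (f := fun n => (d (κ n u) : Ω → ℝ))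
    (fun n => Lp.aestronglyMeasurable _) one_le_two hsum fun N n m hn hm => by
      rw [← Lp.edist_def]
      have hpow : ∀ {k}, N ≤ k → (2⁻¹ : ENNReal) ^ k ≤ 2⁻¹ ^ N := fun h =>
        pow_le_pow_right_of_le_one' (by simp) h
      calc edist (d (κ n u)) (d (κ m u)) ≤ edist (d (κ n u)) (F u) + edist (F u) (d (κ m u)) :=
            edist_triangle _ _ _
        _ < 2⁻¹ ^ N + 2⁻¹ ^ N := by
            refine ENNReal.add_lt_add ?_ ((hκlt m u).trans_le (hpow hm))
            rw [edist_comm]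
            exact (hκlt n u).trans_le (hpow hn)
  filter_upwards [hsub, hae] with ω h1 ⟨l, h2⟩
  rw [h2.limsup_eq]
  exact tendsto_nhds_unique (h2.comp hns.tendsto_atTop) h1

theorem integral_norm_le_norm_Lp [IsProbabilityMeasure P] (f : Lp ℝ 2 P) :
    ∫ ω, ‖f ω‖ ∂P ≤ ‖f‖ := by
  rw [Lp.norm_def, integral_norm_eq_lintegral_enorm (Lp.aestronglyMeasurable f),
    ← eLpNorm_one_eq_lintegral_enorm]
  exact ENNReal.toReal_mono (Lp.memLp f).2.ne
    (eLpNorm_le_eLpNorm_of_exponent_le one_le_two (Lp.aestronglyMeasurable f))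

variable [IsProbabilityMeasure P] {μ : Measure Y} {F : Y → Lp ℝ 2 P} {D : Y × Ω → ℝ}

theorem integrable_prod_of_ae_eq_Lp (hF : Integrable F μ)
    (hD : AEStronglyMeasurable D (μ.prod P)) (h : ∀ᵐ y ∂μ, (fun ω => D (y, ω)) =ᵐ[P] F y) :
    Integrable D (μ.prod P) := by
  refine (integrable_prod_iff hD).2 ⟨?_, hF.norm.mono' hD.norm.integral_prod_right' ?_⟩
  · filter_upwards [h] with y hy
    exact ((Lp.memLp (F y)).integrable one_le_two).congr hy.symm
  · filter_upwards [h] with y hy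
    rw [Real.norm_of_nonneg (integral_nonneg fun _ => norm_nonneg _),
      integral_congr_ae (hy.mono fun ω hω => congrArg norm hω)]
    exact integral_norm_le_norm_Lp (F y)

/-- The Bochner integral of a map into `L²(P)` can be computed path by path, for any jointly
measurable version of the map. -/
theorem integral_path_ae_eq [SFinite μ] (hF : Integrable F μ)
    (hD : AEStronglyMeasurable D (μ.prod P)) (h : ∀ᵐ y ∂μ, (fun ω => D (y, ω)) =ᵐ[P] F y) :
    (fun ω => ∫ y, D (y, ω) ∂μ) =ᵐ[P] (∫ y, F y ∂μ : Lp ℝ 2 P) := by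
  have hint := integrable_prod_of_ae_eq_Lp hF hD h
  refine Integrable.ae_eq_of_forall_setIntegral_eq _ _ hint.integral_prod_right
    ((Lp.memLp _).integrable one_le_two) fun s hs _ => ?_
  rw [← L2.inner_indicatorConstLp_one hs (measure_ne_top P s), ← integral_inner hF]
  have hswap : Integrable (Function.uncurry fun ω y => D (y, ω)) ((P.restrict s).prod μ) := by
    have h1 := hint.swap.restrict (s := s ×ˢ Set.univ)
    rw [← Measure.prod_restrict, Measure.restrict_univ] at h1
    exact h1
  rw [integral_integral_swap hswap]
  refine integral_congr_ae ?_
  filter_upwards [h] with y hy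
  rw [L2.inner_indicatorConstLp_one hs (measure_ne_top P s)]
  exact integral_congr_ae (ae_restrict_of_ae hy)

end MeasurableVersion

/-! ### Stochastic integrals against a process with a drift -/

section StochasticIntegral

variable {E Ω : Type*} [MeasurableSpace E] [MeasurableSpace Ω] {R : Measure E}
  {P : Measure Ω} {ν : ℕ} {q : Fin ν → E → ℝ} {f : E → ℝ}

theorem setL2_simpleFunc [IsFiniteMeasure R] (φ : SimpleFunc E ℝ) (C : BorelSets E) :
    setL2 (φ.memLp_of_isFiniteMeasure 2 R) C =
      ∑ c ∈ φ.range, c • indL2 R (C ∩ ⟨φ ⁻¹' {c}, φ.measurableSet_fiber c⟩) := by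
  refine Lp.ext ?_
  have h1 : ∀ᵐ x ∂ R, ∀ c ∈ φ.range,
      (c • indL2 R (C ∩ ⟨φ ⁻¹' {c}, φ.measurableSet_fiber c⟩) : Lp ℝ 2 R) x =
        c * ((C : Set E) ∩ φ ⁻¹' {c}).indicator (fun _ => (1 : ℝ)) x := by
    refine (Filter.eventually_all_finset _).2 fun c _ => ?_
    filter_upwards [Lp.coeFn_smul c (indL2 R (C ∩ ⟨φ ⁻¹' {c}, φ.measurableSet_fiber c⟩)),
      indicatorConstLp_coeFn (p := 2) (μ := R) (s := (C : Set E) ∩ φ ⁻¹' {c})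
        (hs := C.2.inter (φ.measurableSet_fiber c)) (hμs := measure_ne_top _ _) (c := (1 : ℝ))]
      with x hx hx'
    rw [hx, Pi.smul_apply, smul_eq_mul]
    exact congrArg (c * ·) hx'
  filter_upwards [((φ.memLp_of_isFiniteMeasure 2 R).indicator C.2).coeFn_toLp,
    Lp.coeFn_finsetSum φ.range fun c => c • indL2 R (C ∩ ⟨φ ⁻¹' {c}, φ.measurableSet_fiber c⟩), h1]
    with x hx hx' h1
  rw [setL2, hx, hx', Finset.sum_apply, Finset.sum_congr rfl h1]
  by_cases hxC : x ∈ (C : Set E)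
  · rw [Set.indicator_of_mem hxC, Finset.sum_eq_single_of_mem (φ x) (φ.mem_range_self x)]
    · simp [hxC]
    · intro c _ hc
      simp [hc.symm]
  · simp [hxC]

/-- The stochastic integral of `g ∈ L²(R)` against the process with a drift `V + ∑ j, Q j Z j`, where
`J` is the Wiener integral, the isometry that extends `V`, and `q j` is the density of `Q j`. -/
noncomputable def driftedIntegral (J : Lp ℝ 2 R →ₗᵢ[ℝ] Lp ℝ 2 P) (hq : ∀ j, MemLp (q j) 2 R)
    (Z : Fin ν → Ω → ℝ) (g : Lp ℝ 2 R) (ω : Ω) : ℝ :=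
  J g ω + ∑ j, inner ℝ g ((hq j).toLp (q j)) * Z j ω

variable {J : Lp ℝ 2 R →ₗᵢ[ℝ] Lp ℝ 2 P} {hq : ∀ j, MemLp (q j) 2 R} {Z : Fin ν → Ω → ℝ}

theorem inner_setL2_toLp (hf : MemLp f 2 R) (C : BorelSets E) {g : E → ℝ} (hg : MemLp g 2 R) :
    inner ℝ (setL2 hf C) (hg.toLp g) = ∫ x in (C : Set E), f x * g x ∂ R := by
  rw [← setL2_univ hg (S := ⟨Set.univ, MeasurableSet.univ⟩) rfl, inner_setL2_setL2, Set.inter_univ]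

theorem driftedIntegral_sum {κ : Type*} (s : Finset κ) (a : κ → ℝ) (g : κ → Lp ℝ 2 R) :
    driftedIntegral J hq Z (∑ k ∈ s, a k • g k) =ᵐ[P]
      fun ω => ∑ k ∈ s, a k * driftedIntegral J hq Z (g k) ω := by
  have h1 : ∀ᵐ ω ∂P, ∀ k ∈ s, (a k • J (g k) : Lp ℝ 2 P) ω = a k * J (g k) ω :=
    (Filter.eventually_all_finset _).2 fun k _ => Lp.coeFn_smul (a k) (J (g k))
  filter_upwards [h1, Lp.coeFn_finsetSum s fun k => a k • J (g k)] with ω h1 h2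
  rw [driftedIntegral, map_sum]
  simp only [map_smul]
  rw [h2, Finset.sum_apply, Finset.sum_congr rfl h1]
  simp only [driftedIntegral, mul_add, Finset.sum_add_distrib, sum_inner, real_inner_smul_left,
    Finset.sum_mul, Finset.mul_sum, mul_assoc]
  rw [Finset.sum_comm]

theorem tendstoInMeasure_driftedIntegral [IsFiniteMeasure P] (hZ : ∀ j, Measurable (Z j))
    {ι : Type*} {l : Filter ι} [l.IsCountablyGenerated] {g : ι → Lp ℝ 2 R} {g₀ : Lp ℝ 2 R}
    (hg : Tendsto g l (𝓝 g₀)) :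
    TendstoInMeasure P (fun i => driftedIntegral J hq Z (g i)) l (driftedIntegral J hq Z g₀) :=
  tendstoInMeasure_add
    (tendstoInMeasure_of_tendsto_Lp ((J.continuous.tendsto g₀).comp hg))
    (tendstoInMeasure_finsetSum _ fun j _ =>
      tendstoInMeasure_const_mul (hg.inner tendsto_const_nhds) (hZ j))

variable [IsFiniteMeasure R] {V ξ : BorelSets E → Ω → ℝ} {Q : Fin ν → SignedMeasure E}
  (hJ : ∀ B, J (indL2 R B) =ᵐ[P] V B)
  (hξ : ∀ B ω, ξ B ω = V B ω + ∑ j, Q j (B : Set E) * Z j ω)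
  (hQ : ∀ j, ∀ B : BorelSets E, Q j (B : Set E) = ∫ x in (B : Set E), q j x ∂ R)

include hJ hξ hQ

theorem driftedIntegral_indL2 (B : BorelSets E) :
    driftedIntegral J hq Z (indL2 R B) =ᵐ[P] ξ B := by
  filter_upwards [hJ B] with ω hω
  rw [driftedIntegral, hω]
  simp only [hξ, hQ, indL2_eq_setL2, inner_setL2_toLp, one_mul]

theorem elemIntegral_ae_eq (C : BorelSets E) (φ : SimpleFunc E ℝ) :
    driftedIntegral J hq Z (setL2 (φ.memLp_of_isFiniteMeasure 2 R) C) =ᵐ[P]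
      elemIntegral ξ C φ := by
  have h : ∀ᵐ ω ∂P, ∀ c ∈ φ.range,
      driftedIntegral J hq Z (indL2 R (C ∩ ⟨φ ⁻¹' {c}, φ.measurableSet_fiber c⟩)) ω =
        ξ (C ∩ ⟨φ ⁻¹' {c}, φ.measurableSet_fiber c⟩) ω :=
    (Filter.eventually_all_finset _).2 fun c _ => driftedIntegral_indL2 hJ hξ hQ _
  rw [setL2_simpleFunc]
  filter_upwards [driftedIntegral_sum φ.range (fun c => c)
    (fun c => indL2 R (C ∩ ⟨φ ⁻¹' {c}, φ.measurableSet_fiber c⟩)) (J := J) (hq := hq) (Z := Z), h]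
    with ω h1 h2
  rw [h1, elemIntegral]
  exact Finset.sum_congr rfl fun c hc => by rw [h2 c hc]

theorem isStochIntegral_driftedIntegral [IsFiniteMeasure P] (hZ : ∀ j, Measurable (Z j))
    (hf : MemLp f 2 R) (C : BorelSets E) :
    IsStochIntegral R P ξ C f (driftedIntegral J hq Z (setL2 hf C)) := by
  intro φ hφ
  refine (tendstoInMeasure_driftedIntegral (J := J) (hq := hq) hZ
    (g := fun n => setL2 ((φ n).memLp_of_isFiniteMeasure 2 R) C) ?_).congr_left
    fun n => elemIntegral_ae_eq hJ hξ hQ C (φ n)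
  refine (Lp.tendsto_Lp_iff_tendsto_eLpNorm'' _ _ _ _).2 (hφ.congr fun n => ?_)
  rw [← eLpNorm_indicator_eq_eLpNorm_restrict C.2, ← Set.indicator_sub']
  rfl

/-- The stochastic integral of a square-integrable function is unique, since there are simple
functions that converge to it. -/
theorem IsStochIntegral.ae_eq_driftedIntegral [IsFiniteMeasure P] (hZ : ∀ j, Measurable (Z j))
    (hf : MemLp f 2 R) {C : BorelSets E} {X : Ω → ℝ} (hX : IsStochIntegral R P ξ C f X) :
    X =ᵐ[P] driftedIntegral J hq Z (setL2 hf C) := by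
  have h : ∀ n : ℕ, ∃ φ : SimpleFunc E ℝ, eLpNorm (f - ⇑φ) 2 R < 2⁻¹ ^ n := fun n => by
    obtain ⟨φ, hφ, -⟩ := hf.exists_simpleFunc_eLpNorm_sub_lt (by norm_num)
      (ENNReal.pow_pos (a := 2⁻¹) (by simp) n).ne'
    exact ⟨φ, hφ⟩
  choose φ hφ using h
  have hlim : Tendsto (fun n => eLpNorm (fun x => φ n x - f x) 2 (R.restrict (C : Set E))) atTop
      (𝓝 0) := by
    refine tendsto_of_tendsto_of_tendsto_of_le_of_le tendsto_const_nhds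
      (ENNReal.tendsto_pow_atTop_nhds_zero_of_lt_one (r := 2⁻¹) (by simp)) (fun _ => zero_le)
      fun n => ?_
    refine (eLpNorm_mono_measure _ Measure.restrict_le_self).trans ?_
    exact (eLpNorm_sub_comm (φ n) f 2 R).le.trans (hφ n).le
  exact tendstoInMeasure_ae_unique (hX φ hlim)
    (isStochIntegral_driftedIntegral hJ hξ hQ hZ hf C φ hlim)

end StochasticIntegral

/-! ### Integrals of the estimates of the drift -/

section PathIntegral

variable {E Ω : Type*} [MeasurableSpace E] [MeasurableSpace Ω] {R : Measure E}
  {P : Measure Ω} {ν : ℕ} {q : Fin ν → E → ℝ} {t : E → I} {J : Lp ℝ 2 R →ₗᵢ[ℝ] Lp ℝ 2 P}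
  {Z : Fin ν → Ω → ℝ} {M : I → Ω → Fin ν → ℝ} (hq : ∀ j, MemLp (q j) 2 R) (ht : Measurable t)

theorem inner_tailScore_toLp (i k : Fin ν) (u : I) :
    inner ℝ (tailScore hq ht i u) ((hq k).toLp (q k)) = tailInfo R q ht u i k :=
  inner_setL2_toLp (hq i) (tailSet ht u) (hq k)

theorem inner_dualScore_toLp {u : I} (hu : IsUnit (tailInfo R q ht u)) (j k : Fin ν) :
    inner ℝ (dualScore hq ht j u) ((hq k).toLp (q k)) = (1 : Matrix (Fin ν) (Fin ν) ℝ) j k := by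
  rw [Matrix.isUnit_iff_isUnit_det] at hu
  rw [← Matrix.nonsing_inv_mul _ hu, Matrix.mul_apply, dualScore, sum_inner]
  simp only [real_inner_smul_left, inner_tailScore_toLp]

/-- The least-squares estimate `I⁻¹(u) ∫_{t > u} q dξ` of `Z` from the part of `ξ` that is not yet
scanned at time `u` is `Z` plus a centred Gaussian error. -/
theorem inv_mulVec_ae_eq {u : I} (hu : IsUnit (tailInfo R q ht u))
    (hM : ∀ j, (fun ω => M u ω j) =ᵐ[P] driftedIntegral J hq Z (tailScore hq ht j u))
    (j : Fin ν) :
    (fun ω => ((tailInfo R q ht u)⁻¹ *ᵥ M u ω) j) =ᵐ[P]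
      fun ω => J (dualScore hq ht j u) ω + Z j ω := by
  have h2 : ∀ ω, driftedIntegral J hq Z (dualScore hq ht j u) ω =
      J (dualScore hq ht j u) ω + Z j ω := fun ω => by
    simp [driftedIntegral, inner_dualScore_toLp hq ht hu, Matrix.one_apply]
  have h3 : ∀ᵐ ω ∂P, ∀ i, M u ω i = driftedIntegral J hq Z (tailScore hq ht i u) ω :=
    ae_all_iff.2 hM
  filter_upwards [h3, driftedIntegral_sum (J := J) (hq := hq) (Z := Z) Finset.univ
    (fun i => (tailInfo R q ht u)⁻¹ j i) fun i => tailScore hq ht i u] with ω h3 h4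
  rw [← h2, dualScore, h4, Matrix.mulVec, dotProduct]
  simp only [h3]

variable [IsFiniteMeasure R] [IsProbabilityMeasure P] (hat : ∀ u, R (t ⁻¹' {u}) = 0)
  (hI : ∀ u < 1, IsUnit (tailInfo R q ht u))
  (hMm : Measurable (Function.uncurry M))
  (hM : ∀ u < 1, ∀ j, (fun ω => M u ω j) =ᵐ[P] driftedIntegral J hq Z (tailScore hq ht j u))

include hq hat hMm in
theorem measurable_inv_mulVec (j : Fin ν) :
    Measurable fun p : I × Ω => ((tailInfo R q ht p.1)⁻¹ *ᵥ M p.1 p.2) j := by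
  simp only [Matrix.mulVec, dotProduct]
  exact Finset.measurable_sum _ fun i _ =>
    ((measurable_tailInfo_inv hq ht hat j i).comp measurable_fst).mul
      ((measurable_pi_apply i).comp hMm)

include hq hat hMm in
theorem measurable_inv_mulVec_left (j : Fin ν) (ω : Ω) :
    Measurable fun u => ((tailInfo R q ht u)⁻¹ *ᵥ M u ω) j :=
  (measurable_inv_mulVec hq ht hat hMm j).comp (g := fun p : I × Ω =>
    ((tailInfo R q ht p.1)⁻¹ *ᵥ M p.1 p.2) j) (f := fun u => (u, ω)) measurable_prodMk_right

include hat hI hMm hM in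
/-- The path-by-path integral of the estimates is the Wiener integral of a Bochner integral of dual
scores, plus a multiple of `Z j`. -/
theorem path_integral_estimate (hZ : ∀ j, Measurable (Z j)) {s : I} (hs : s < 1) {f : E → ℝ}
    (hf : Integrable f R) (j : Fin ν) :
    ∀ᵐ ω ∂P,
      IntegrableOn (fun y => f y * ((tailInfo R q ht (t y))⁻¹ *ᵥ M (t y) ω) j)
        (headSet ht s : Set E) R ∧
      ∫ y in (headSet ht s : Set E), f y * ((tailInfo R q ht (t y))⁻¹ *ᵥ M (t y) ω) j ∂ R =
        J (∫ y in (headSet ht s : Set E), f y • dualScore hq ht j (t y) ∂ R) ω +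
          (∫ y in (headSet ht s : Set E), f y ∂ R) * Z j ω := by
  set G : I → Ω → ℝ := fun u ω => ((tailInfo R q ht u)⁻¹ *ᵥ M u ω) j with hG
  set μ := R.restrict (headSet ht s : Set E) with hμ
  have hfμ : Integrable f μ := hf.integrableOn
  have hk : Integrable (fun y => f y • dualScore hq ht j (t y)) μ :=
    integrable_smul_dualScore hq ht hat hI hs hf j
  have hF : Integrable (fun y => J (f y • dualScore hq ht j (t y))) μ :=
    J.toContinuousLinearMap.integrable_comp hk
  have hD : AEStronglyMeasurable (fun p : E × Ω => f p.1 * (G (t p.1) p.2 - Z j p.2))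
      (μ.prod P) :=
    hfμ.aestronglyMeasurable.comp_fst.mul
      (((measurable_inv_mulVec hq ht hat hMm j).comp
        ((ht.comp measurable_fst).prodMk measurable_snd)).sub
          ((hZ j).comp measurable_snd)).aestronglyMeasurable
  have hae : ∀ᵐ y ∂μ, (fun ω => f y * (G (t y) ω - Z j ω)) =ᵐ[P]
      J (f y • dualScore hq ht j (t y)) := by
    filter_upwards [ae_restrict_mem (headSet ht s).2] with y hy
    have hy1 : t y < 1 := lt_of_le_of_lt hy hs
    rw [map_smul]
    filter_upwards [inv_mulVec_ae_eq hq ht (hI _ hy1) (hM _ hy1) j,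
      Lp.coeFn_smul (f y) (J (dualScore hq ht j (t y)))] with ω h1 h2
    rw [h2, Pi.smul_apply, smul_eq_mul, hG]
    simp only
    rw [h1, add_sub_cancel_right]
  have hJ : ∫ y, J (f y • dualScore hq ht j (t y)) ∂μ =
      J (∫ y, f y • dualScore hq ht j (t y) ∂μ) :=
    J.toContinuousLinearMap.integral_comp_comm hk
  have hpath := integral_path_ae_eq hF hD hae
  rw [hJ] at hpath
  filter_upwards [hpath, (integrable_prod_of_ae_eq_Lp hF hD hae).prod_left_ae] with ω h1 h2
  have hsplit : (fun y => f y * G (t y) ω) =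
      fun y => f y * (G (t y) ω - Z j ω) + f y * Z j ω := by
    ext y; ring
  refine ⟨?_, ?_⟩
  · rw [hsplit]
    exact h2.add (hfμ.mul_const _)
  · rw [hsplit, integral_add h2 (hfμ.mul_const _), integral_mul_const]
    exact congrArg (· + _) h1

end PathIntegral

/-! ### The innovation transform -/

section Innovation

variable {E Ω : Type*} [MeasurableSpace E] [MeasurableSpace Ω] {R : Measure E} [IsFiniteMeasure R]
  {P : Measure Ω} {ν : ℕ} {q : Fin ν → E → ℝ} {A : I → BorelSets E}
  {J : Lp ℝ 2 R →ₗᵢ[ℝ] Lp ℝ 2 P} {Z : Fin ν → Ω → ℝ} {V ξ : BorelSets E → Ω → ℝ}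
  {Q : Fin ν → SignedMeasure E} {M : I → Ω → Fin ν → ℝ}
  (hq : ∀ j, MemLp (q j) 2 R)
  (hA : ∀ u u' : I, u ≤ u' → (A u : Set E) ⊆ (A u' : Set E))
  (hone : R (A 1 : Set E)ᶜ = 0) (hcont : Continuous fun u : I => R (A u : Set E))

include hone hcont in
theorem infoMatrix_compl_eq (u : I) :
    infoMatrix R q (A u)ᶜ = tailInfo R q (measurable_arrival hA) u := by
  ext i j
  exact setIntegral_congr_set (compl_ae_eq_tailSet hA hone hcont u)

include hone hcont in
theorem setL2_compl_eq (j : Fin ν) (u : I) :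
    setL2 (hq j) (A u)ᶜ = tailScore hq (measurable_arrival hA) j u :=
  setL2_congr_set (hq j) (compl_ae_eq_tailSet hA hone hcont u)

variable (hzero : R (A 0 : Set E) = 0) (hZ : ∀ j, Measurable (Z j))
  (hQ : ∀ j, ∀ B : BorelSets E, Q j (B : Set E) = ∫ x in (B : Set E), q j x ∂ R)
  (hI : ∀ u < 1, IsUnit (tailInfo R q (measurable_arrival hA) u))

include hone hcont hzero in
/-- The stochastic integrals of the scores over the tails have a jointly measurable version. -/
theorem exists_measurable_tailScore_version (J : Lp ℝ 2 R →ₗᵢ[ℝ] Lp ℝ 2 P)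
    (hZ : ∀ j, Measurable (Z j)) :
    ∃ M : I → Ω → Fin ν → ℝ, Measurable (Function.uncurry M) ∧
      ∀ u j, (fun ω => M u ω j) =ᵐ[P]
        driftedIntegral J hq Z (tailScore hq (measurable_arrival hA) j u) := by
  have ht := measurable_arrival hA
  have hc : ∀ j, Continuous fun u => tailScore hq ht j u := fun j =>
    continuous_setL2_tailSet (hq j) ht (measure_arrival_eq hA hone hcont hzero)
  have hN := fun j => exists_measurable_uncurry_version (P := P)
    (F := fun u => J (tailScore hq ht j u)) (J.continuous.comp (hc j)).stronglyMeasurable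
  choose N hNm hN using hN
  refine ⟨fun u ω j => N j u ω +
    ∑ k, inner ℝ (tailScore hq ht j u) ((hq k).toLp (q k)) * Z k ω, ?_, fun u j => ?_⟩
  · refine measurable_pi_lambda _ fun j => (hNm j).add (Finset.measurable_sum _ fun k _ => ?_)
    exact (((hc j).inner continuous_const).measurable.comp measurable_fst).mul
      ((hZ k).comp measurable_snd)
  · filter_upwards [hN j u] with ω hω
    rw [driftedIntegral, ← hω]

variable [IsProbabilityMeasure P] (hMm : Measurable (Function.uncurry M))
  (hM : ∀ u < 1, ∀ j, (fun ω => M u ω j) =ᵐ[P]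
    driftedIntegral J hq Z (tailScore hq (measurable_arrival hA) j u))

include hone hcont hzero hZ hQ hI hMm hM

theorem integrableOn_estimate (B : BorelSets E) {s : I} (hs : s < 1) (j : Fin ν) :
    ∀ᵐ ω ∂P, (scanMeasure (Q j) A hA B).IntegrableOn
      (fun u => ((tailInfo R q (measurable_arrival hA) u)⁻¹ *ᵥ M u ω) j) (Set.Iic s) := by
  have ht := measurable_arrival hA
  have hat := measure_arrival_eq hA hone hcont hzero
  have hqi : Integrable (q j) R := (hq j).integrable one_le_two
  filter_upwards [path_integral_estimate hq ht hat hI hMm hM hZ hs (hqi.indicator B.2) j]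
    with ω hω
  exact integrableOn_scanMeasure hA hone hcont (hq j) (hQ j) hzero B s
    (measurable_inv_mulVec_left hq ht hat hMm j ω) hω.1

/-- The outer integral up to time `s` is the Wiener integral of the compensator of `1_B`, plus the
drift that the scanning has collected. -/
theorem sum_integral_scanMeasure_ae_eq (B : BorelSets E) {s : I} (hs : s < 1) :
    (fun ω => ∑ j, ∫ᵛ u in Set.Iic s,
        ((tailInfo R q (measurable_arrival hA) u)⁻¹ *ᵥ M u ω) j ∂•(scanMeasure (Q j) A hA B))
      =ᵐ[P] fun ω => J (compensator hq (measurable_arrival hA) s ((B : Set E).indicator 1)) ω +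
        ∑ j, Q j ((B : Set E) ∩ A s) * Z j ω := by
  have ht := measurable_arrival hA
  have hat := measure_arrival_eq hA hone hcont hzero
  have hqi : ∀ j, Integrable ((B : Set E).indicator (q j)) R := fun j =>
    ((hq j).integrable one_le_two).indicator B.2
  have h1 : ∀ᵐ ω ∂P, ∀ j, _ := ae_all_iff.2 fun j =>
    path_integral_estimate hq ht hat hI hMm hM hZ hs (hqi j) j
  have hcomp : compensator hq ht s ((B : Set E).indicator 1) = ∑ j,
      ∫ y in (headSet ht s : Set E),
        (B : Set E).indicator (q j) y • dualScore hq ht j (arrival A y) ∂ R := by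
    rw [compensator, ← integral_finsetSum _ fun j _ =>
      integrable_smul_dualScore hq ht hat hI hs (hqi j) j]
    refine integral_congr_ae (ae_of_all _ fun y => ?_)
    by_cases hy : y ∈ (B : Set E) <;> simp [compIntegrand, hy]
  rw [hcomp, map_sum]
  filter_upwards [h1, Lp.coeFn_finsetSum Finset.univ fun j =>
    J (∫ y in (headSet ht s : Set E),
      (B : Set E).indicator (q j) y • dualScore hq ht j (arrival A y) ∂ R)] with ω hω h2
  rw [h2, Finset.sum_apply, ← Finset.sum_add_distrib]
  refine Finset.sum_congr rfl fun j _ => ?_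
  rw [integral_scanMeasure hA hone hcont (hq j) (hQ j) hzero B s
    (measurable_inv_mulVec_left hq ht hat hMm j ω) (hω j).1,
    apply_inter_scan hA hone hcont (hQ j)]
  exact (hω j).2

/-- The innovation transform at `B` is the Wiener integral of `1_B` minus its limiting compensator;
the drift cancels, as the scanning exhausts `B`. -/
theorem tendstoInMeasure_innovation (hJ : ∀ B, J (indL2 R B) =ᵐ[P] V B)
    (hξ : ∀ B ω, ξ B ω = V B ω + ∑ j, Q j (B : Set E) * Z j ω) (B : BorelSets E) {k : Lp ℝ 2 R}
    (hk : Tendsto (fun s => compensator hq (measurable_arrival hA) s ((B : Set E).indicator 1))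
      (𝓝[<] 1) (𝓝 k)) :
    TendstoInMeasure P
      (fun (s : I) ω => ξ B ω - ∑ j, ∫ᵛ u in Set.Iic s,
        ((tailInfo R q (measurable_arrival hA) u)⁻¹ *ᵥ M u ω) j ∂•(scanMeasure (Q j) A hA B))
      (𝓝[<] 1) (J (indL2 R B - k)) := by
  have hB : ∀ j, Q j ((B : Set E) ∩ A 1) = Q j (B : Set E) := fun j => by
    have : Set.Iic (1 : I) = Set.univ := Set.Iic_top
    rw [apply_inter_scan hA hone hcont (hQ j), hQ, this, Set.preimage_univ, Measure.restrict_univ,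
      integral_indicator B.2]
  have hdrift : ∀ j, Tendsto (fun s => Q j (B : Set E) - Q j ((B : Set E) ∩ A s)) (𝓝[<] 1)
      (𝓝 0) := fun j => by
    have h := (continuous_apply_inter_scan hA hone hcont (hq j) (hQ j) hzero B).tendsto 1
    rw [hB] at h
    simpa using (tendsto_const_nhds (x := Q j (B : Set E))).sub
      (h.mono_left (nhdsWithin_le_nhds (s := Set.Iio 1)))
  have hmain := tendstoInMeasure_add
    (tendstoInMeasure_of_tendsto_Lp (μ := P) ((J.continuous.tendsto (indL2 R B - k)).comp
      ((tendsto_const_nhds (x := indL2 R B)).sub hk)))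
    (tendstoInMeasure_finsetSum (P := P) Finset.univ fun j _ =>
      tendstoInMeasure_const_mul (hdrift j) (hZ j))
  refine hmain.congr' ?_ (ae_of_all _ fun ω => by simp)
  filter_upwards [self_mem_nhdsWithin] with s hs
  filter_upwards [sum_integral_scanMeasure_ae_eq hq hA hone hcont hzero hZ hQ hI hMm hM B hs, hJ B,
    Lp.coeFn_sub (J (indL2 R B))
      (J (compensator hq (measurable_arrival hA) s ((B : Set E).indicator 1)))] with ω h1 h2 h3
  rw [h1, hξ, Function.comp_apply, map_sub, h3, Pi.sub_apply, h2]
  simp only [sub_mul, Finset.sum_sub_distrib]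
  ring

end Innovation

/-! ### The innovation transform is a Wiener process -/

theorem theorem2 {δ T : ℝ} (hδ : 0 < δ) (hT : δ < T)
    {Ω : Type*} [MeasurableSpace Ω] (P : Measure Ω) [IsProbabilityMeasure P]
    (R : Measure (Square δ T)) [IsFiniteMeasure R]
    {ν : ℕ}
    (V : BorelSets (Square δ T) → Ω → ℝ) (hV : IsSetIndexedWiener R P V)
    (Z : Fin ν → Ω → ℝ) (hZ : ∀ j, Measurable (Z j))
    (Q : Fin ν → SignedMeasure (Square δ T))
    (ξ : BorelSets (Square δ T) → Ω → ℝ)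
    (hξ : ∀ B ω, ξ B ω = V B ω + ∑ j, Q j (B : Set (Square δ T)) * Z j ω)
    (q : Fin ν → Square δ T → ℝ) (hq : ∀ j, MemLp (q j) 2 R)
    (hQ : ∀ j, ∀ B : BorelSets (Square δ T),
      Q j (B : Set (Square δ T)) = ∫ x in (B : Set (Square δ T)), q j x ∂ R)
    (A : I → BorelSets (Square δ T)) (hA : IsScanningFamily A)
    -- the scanning starts and ends at `R`-null sets and has no jumps of positive `R`-measure
    (hA_zero : R (A 0 : Set (Square δ T)) = 0)
    (hA_one : R (A 1 : Set (Square δ T))ᶜ = 0)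
    (hA_cont : Continuous fun u : I => R (A u : Set (Square δ T)))
    (hI : ∀ u : I, u < 1 → IsUnit (infoMatrix R q (A u)ᶜ)) :
    (∃ W, IsInnovationTransform R P Q q A hA.mono ξ W) ∧
      ∀ W, IsInnovationTransform R P Q q A hA.mono ξ W → IsSetIndexedWiener R P W := by
  have ht := measurable_arrival hA.mono
  have hat := measure_arrival_eq hA.mono hA_one hA_cont hA_zero
  have hinfo : ∀ u, infoMatrix R q (A u)ᶜ = tailInfo R q ht u :=
    infoMatrix_compl_eq hA.mono hA_one hA_cont
  have hscore : ∀ j u, setL2 (hq j) (A u)ᶜ = tailScore hq ht j u :=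
    setL2_compl_eq hq hA.mono hA_one hA_cont
  have hIt : ∀ u < 1, IsUnit (tailInfo R q ht u) := fun u hu => hinfo u ▸ hI u hu
  obtain ⟨J, hJ⟩ := hV.exists_linearIsometry
  have h1 : ∀ B : BorelSets (Square δ T),
      MemLp ((B : Set (Square δ T)).indicator (1 : Square δ T → ℝ)) 2 R :=
    fun B => (memLp_const (1 : ℝ)).indicator B.2
  choose k hk using fun B => exists_tendsto_compensator hq ht hat hIt (h1 B)
  constructor
  · obtain ⟨M, hMm, hM⟩ :=
      exists_measurable_tailScore_version hq hA.mono hA_one hA_cont hA_zero J hZ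
    refine ⟨fun B => J (indL2 R B - k B), M, hMm, fun u _ j => ?_, fun B => ⟨?_, ?_⟩⟩
    · have h := isStochIntegral_driftedIntegral (hq := hq) hJ hξ hQ hZ (hq j) (A u)ᶜ
      rw [hscore] at h
      exact fun φ hφ => (h φ hφ).congr_right (hM u j).symm
    · intro s hs j
      simp only [hinfo]
      exact integrableOn_estimate hq hA.mono hA_one hA_cont hA_zero hZ hQ hIt hMm
        (fun u _ => hM u) B hs j
    · simp only [hinfo]
      exact tendstoInMeasure_innovation hq hA.mono hA_one hA_cont hA_zero hZ hQ hIt hMm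
        (fun u _ => hM u) hJ hξ B (hk B)
  · rintro W ⟨M, hMm, hM, hW⟩
    have hM' : ∀ u < 1, ∀ j, (fun ω => M u ω j) =ᵐ[P]
        driftedIntegral J hq Z (tailScore hq ht j u) :=
      fun u hu j => hscore j u ▸ (hM u hu j).ae_eq_driftedIntegral hJ hξ hQ hZ (hq j)
    refine isSetIndexedWiener_of_ae_eq hV hJ (fun B => indL2 R B - k B)
      (fun B B' => inner_sub_limit_compensator hq ht hat hIt (h1 B) (h1 B') (hk B) (hk B'))
      fun B => ?_
    have h := (hW B).2
    simp only [hinfo] at h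
    exact tendstoInMeasure_ae_unique
      (tendstoInMeasure_innovation hq hA.mono hA_one hA_cont hA_zero hZ hQ hIt hMm hM' hJ hξ
        B (hk B)) h
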